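/- Let $(\mathcal G,\mu)$ be a (non-singular) discrete measured groupoid: $\mathcal G$ is a groupoid that is a standard Borel space, with Borel unit space $\mathcal G^{(0)}$, countable-to-one Borel source and target maps $s,t$, and Borel composition and inversion, and $\mu$ is a probability measure on $\mathcal G^{(0)}$ such that the measures $\mu_s(A)=\int |A\cap s^{-1}(x)|\,d\mu(x)$ and $\mu_t(A)=\int |A\cap t^{-1}(x)|\,d\mu(x)$ on $\mathcal G$ are equivalent. Let $\omega$ be a Borel $2$-cocycle on $\mathcal G$ with values in $\mathbb T$, that is, $\omega(x,yz)\omega(y,z)=\omega(xy,z)\omega(x,y)$ for composable $x,y,z$, which is normalized by $\omega(x,s(x))=\omega(t(x),x)=\omega(x,x^{-1})=1$ for all $x$. A Borel bisection is a Borel set $A\subset\mathcal G$ on which $s$ and $t$ are injective. For a Borel bisection $A$, let $\lambda_A^\omega$ be the bounded operator on $L^2(\mathcal G,\mu_s)$ such that, for every Borel $E$ with $\mu_s(E)<\infty$, the function $\lambda^\omega_A1_E$ equals $\omega(a,e)$ at $ae$ for composable $a\in A$, $e\in E$ and vanishes off $A\cdot E$; and let $\rho_A^\omega$ be the operator such that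 $\rho^\omega_A1_E$ equals $\overline{\omega(e,b)}$ at $eb$ for composable $e\in E$, $b\in A^{-1}$ and vanishes off $E\cdot A^{-1}$. The operator $\rho_A^\omega$ is considered for those $A$ for which this formula defines a bounded operator on $L^2(\mathcal G,\mu_s)$, i.e. for which there is $c<\infty$ with $\mu_s(E\cdot A^{-1})\le c\,\mu_s(E)$ for all Borel $E$ (every $A$, if $\mu_s=\mu_t$). Set $$L_\omega(\mathcal G)=\{\lambda_A^\omega\}'',\qquad R_\omega(\mathcal G)=\{\rho_A^\omega\}''.$$ For functions $f,g$ let $(f*_\omega g)(x)=\sum_{ab=x}\omega(a,b)f(a)g(b)$. A function $f\in L^2(\mathcal G,\mu_s)$ is a left (respectively right) convolver for $\omega$ if for every $g\in L^2(\mathcal G,\mu_s)$ the series defining $f*_\omega g$ (respectively $g*_{\overline\omega}f$) converges absolutely $\mu_s$-almost everywhere and its sum lies in $L^2(\mathcal G,\mu_s)$. Let $LC_\omega(\mathcal G)$ be the set of the operators $L_f^\omega\colon g\mapsto f*_\omega g$ for left convolvers $f$, and $RC_\omega(\mathcal G)$ the set of the operators $R_f^\omega\colon g\mapsto g*_{\overline\omega}f$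 for right convolvers $f$. Then the operators $\lambda_A^\omega$, $\rho_A^{\overline\omega}$ (for $A$ as described), $L_f^\omega$ and $R_f^{\overline\omega}$ are well defined and bounded, and $$L_\omega(\mathcal G)=LC_\omega(\mathcal G)=R_{\overline\omega}(\mathcal G)',\qquad R_{\overline\omega}(\mathcal G)=RC_{\overline\omega}(\mathcal G)=L_\omega(\mathcal G)'.$$ -/

import Mathlib

open MeasureTheory
open scoped ENNReal NNReal

/-- A discrete Borel groupoid on a measurable space `G` of arrows (assumed standard Borel in the
theorem). Units are identified with identity arrows, so source and target are maps `G → G`.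
The value `mul g h` is meaningful only if `src g = tgt h`; no law constrains it otherwise. -/
structure DiscreteBorelGroupoid (G : Type*) [MeasurableSpace G] where
  src : G → G
  tgt : G → G
  mul : G → G → G
  inv : G → G
  src_src : ∀ g, src (src g) = src g
  tgt_src : ∀ g, tgt (src g) = src g
  src_tgt : ∀ g, src (tgt g) = tgt g
  tgt_tgt : ∀ g, tgt (tgt g) = tgt g
  src_mul : ∀ g h, src g = tgt h → src (mul g h) = src h
  tgt_mul : ∀ g h, src g = tgt h → tgt (mul g h) = tgt g
  mul_assoc : ∀ g h k, src g = tgt h → src h = tgt k → mul (mul g h) k = mul g (mul h k)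
  tgt_mul_self : ∀ g, mul (tgt g) g = g
  mul_src_self : ∀ g, mul g (src g) = g
  src_inv : ∀ g, src (inv g) = tgt g
  tgt_inv : ∀ g, tgt (inv g) = src g
  mul_inv : ∀ g, mul g (inv g) = tgt g
  inv_mul : ∀ g, mul (inv g) g = src g
  measurableSet_units : MeasurableSet {g | src g = g}
  measurable_src : Measurable src
  measurable_tgt : Measurable tgt
  countable_src_fiber : ∀ x, (src ⁻¹' {x}).Countable
  countable_tgt_fiber : ∀ x, (tgt ⁻¹' {x}).Countable
  measurable_mul :
    Measurable (fun p : {p : G × G // src p.1 = tgt p.2} => mul p.1.1 p.1.2)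
  measurable_inv : Measurable inv

namespace DiscreteBorelGroupoid

noncomputable section

variable {G : Type*} [MeasurableSpace G] (𝒢 : DiscreteBorelGroupoid G)

/-- The unit space. -/
def units : Set G := {g | 𝒢.src g = g}

/-- The product `A · B` of two sets of arrows. -/
def setMul (A B : Set G) : Set G :=
  {g | ∃ a ∈ A, ∃ b ∈ B, 𝒢.src a = 𝒢.tgt b ∧ 𝒢.mul a b = g}

/-- The set `A⁻¹` of inverses of the elements of `A`. -/
def setInv (A : Set G) : Set G := 𝒢.inv '' A

/-- Borel (partial) bisections. -/
structure IsBorelBisection (A : Set G) : Prop where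
  measurableSet : MeasurableSet A
  injOn_src : Set.InjOn 𝒢.src A
  injOn_tgt : Set.InjOn 𝒢.tgt A

/-- The measure `μ_s(A) = ∫ |{g ∈ A | s(g) = x}| dμ(x)`. (The integrand is Borel in `x` since `s`
is a countable-to-one Borel map on a standard Borel space.) -/
def muS (μ : Measure G) : Measure G :=
  μ.bind fun x => Measure.count.restrict (𝒢.src ⁻¹' {x})

/-- The measure `μ_t(A) = ∫ |{g ∈ A | t(g) = x}| dμ(x)`. -/
def muT (μ : Measure G) : Measure G :=
  μ.bind fun x => Measure.count.restrict (𝒢.tgt ⁻¹' {x})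

/-- `(𝒢, μ)` is a (non-singular) discrete measured groupoid: `μ` is a probability measure on the
unit space (regarded as a measure on `G` concentrated on the units), and `μ_s`, `μ_t` are
equivalent. -/
structure IsMeasured (μ : Measure G) : Prop where
  isProbabilityMeasure : IsProbabilityMeasure μ
  units_compl : μ 𝒢.unitsᶜ = 0
  muS_ac_muT : 𝒢.muS μ ≪ 𝒢.muT μ
  muT_ac_muS : 𝒢.muT μ ≪ 𝒢.muS μ

/-- Circle-valued Borel 2-cocycles, normalized and with `ω(x, x⁻¹) = 1`. Only the values on
composable pairs are meaningful. -/
structure Cocycle where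
  toFun : G → G → Circle
  measurable_toFun :
    Measurable (fun p : {p : G × G // 𝒢.src p.1 = 𝒢.tgt p.2} => (toFun p.1.1 p.1.2 : ℂ))
  cocycle : ∀ x y z, 𝒢.src x = 𝒢.tgt y → 𝒢.src y = 𝒢.tgt z →
    toFun x (𝒢.mul y z) * toFun y z = toFun (𝒢.mul x y) z * toFun x y
  map_src : ∀ x, toFun x (𝒢.src x) = 1
  map_tgt : ∀ x, toFun (𝒢.tgt x) x = 1
  map_inv : ∀ x, toFun x (𝒢.inv x) = 1

variable {𝒢}

/-- The complex conjugate cocycle; on `Circle`, inversion is complex conjugation. -/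
def Cocycle.conj (ω : 𝒢.Cocycle) : 𝒢.Cocycle where
  toFun x y := (ω.toFun x y)⁻¹
  measurable_toFun := by
    simp only [Circle.coe_inv]
    exact ω.measurable_toFun.inv
  cocycle x y z hxy hyz := by
    rw [← _root_.mul_inv, ← _root_.mul_inv, ω.cocycle x y z hxy hyz]
  map_src x := by rw [ω.map_src, inv_one]
  map_tgt x := by rw [ω.map_tgt, inv_one]
  map_inv x := by rw [ω.map_inv, inv_one]

variable (𝒢) in
/-- The Hilbert space `L²(𝒢, μ_s)`. -/
abbrev L2 (μ : Measure G) : Type _ := Lp ℂ 2 (𝒢.muS μ)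

/-- `T` is the operator `λ_A^ω`: for all Borel `E` of finite measure, `T 1_E` takes the value
`ω(a, e)` at `g = a e` with `a ∈ A`, `e ∈ E`, and vanishes outside `A · E`. -/
def IsLeftTranslation (μ : Measure G) (ω : 𝒢.Cocycle) (A : Set G)
    (T : 𝒢.L2 μ →L[ℂ] 𝒢.L2 μ) : Prop :=
  ∀ (E : Set G) (hE : MeasurableSet E) (hfin : 𝒢.muS μ E ≠ ∞), ∀ᵐ g ∂(𝒢.muS μ),
    (∀ a ∈ A, ∀ e ∈ E, 𝒢.src a = 𝒢.tgt e → 𝒢.mul a e = g →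
      T (indicatorConstLp 2 hE hfin 1) g = (ω.toFun a e : ℂ)) ∧
    (g ∉ 𝒢.setMul A E → T (indicatorConstLp 2 hE hfin 1) g = 0)

/-- `T` is the operator `ρ_A^ω`: for all Borel `E` of finite measure, `T 1_E` takes the value
`conj (ω(e, b))` at `g = e b` with `e ∈ E`, `b ∈ A⁻¹`, and vanishes outside `E · A⁻¹`.
If `μ` is not invariant, such a bounded operator exists precisely for those bisections `A` for
which `μ_s(E · A⁻¹)` is bounded by a constant multiple of `μ_s(E)`. -/
def IsRightTranslation (μ : Measure G) (ω : 𝒢.Cocycle) (A : Set G)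
    (T : 𝒢.L2 μ →L[ℂ] 𝒢.L2 μ) : Prop :=
  ∀ (E : Set G) (hE : MeasurableSet E) (hfin : 𝒢.muS μ E ≠ ∞), ∀ᵐ g ∂(𝒢.muS μ),
    (∀ b ∈ 𝒢.setInv A, ∀ e ∈ E, 𝒢.src e = 𝒢.tgt b → 𝒢.mul e b = g →
      T (indicatorConstLp 2 hE hfin 1) g = star (ω.toFun e b : ℂ)) ∧
    (g ∉ 𝒢.setMul E (𝒢.setInv A) → T (indicatorConstLp 2 hE hfin 1) g = 0)

/-- The left twisted groupoid von Neumann algebra `L_ω(𝒢) = {λ_A^ω}''`. -/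
def leftVN (μ : Measure G) (ω : 𝒢.Cocycle) : Set (𝒢.L2 μ →L[ℂ] 𝒢.L2 μ) :=
  Set.centralizer (Set.centralizer
    {T | ∃ A, 𝒢.IsBorelBisection A ∧ IsLeftTranslation μ ω A T})

/-- The right twisted groupoid von Neumann algebra `R_ω(𝒢) = {ρ_A^ω}''`, generated by all the
`ρ_A^ω` that are bounded operators. -/
def rightVN (μ : Measure G) (ω : 𝒢.Cocycle) : Set (𝒢.L2 μ →L[ℂ] 𝒢.L2 μ) :=
  Set.centralizer (Set.centralizer
    {T | ∃ A, 𝒢.IsBorelBisection A ∧ IsRightTranslation μ ω A T})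

variable (𝒢) in
/-- The pairs `(a, b)` of composable arrows with `a b = x`. -/
def factorizations (x : G) : Set (G × G) :=
  {p | 𝒢.src p.1 = 𝒢.tgt p.2 ∧ 𝒢.mul p.1 p.2 = x}

/-- The twisted convolution `(f *_ω g)(x) = ∑_{ab = x} ω(a, b) f(a) g(b)`. -/
def conv (ω : 𝒢.Cocycle) (f g : G → ℂ) (x : G) : ℂ :=
  ∑' p : 𝒢.factorizations x, (ω.toFun p.1.1 p.1.2 : ℂ) * f p.1.1 * g p.1.2

/-- `f *_ω g` is a well-defined element of `L²(𝒢, μ_s)`: the defining series converges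
(absolutely) almost everywhere, and its sum is square integrable. -/
def ConvMemL2 (μ : Measure G) (ω : 𝒢.Cocycle) (f g : G → ℂ) : Prop :=
  (∀ᵐ x ∂(𝒢.muS μ), Summable fun p : 𝒢.factorizations x =>
    (ω.toFun p.1.1 p.1.2 : ℂ) * f p.1.1 * g p.1.2) ∧
  MemLp (conv ω f g) 2 (𝒢.muS μ)

/-- Left convolvers for `(𝒢, ω)`. -/
def IsLeftConvolver (μ : Measure G) (ω : 𝒢.Cocycle) (f : 𝒢.L2 μ) : Prop :=
  ∀ g : 𝒢.L2 μ, ConvMemL2 μ ω f g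

/-- Right convolvers for `(𝒢, ω)`. As in the definition of `ρ^ω`, the right-handed objects
attached to `ω` involve the conjugate of `ω`. -/
def IsRightConvolver (μ : Measure G) (ω : 𝒢.Cocycle) (f : 𝒢.L2 μ) : Prop :=
  ∀ g : 𝒢.L2 μ, ConvMemL2 μ ω.conj g f

/-- `T` is the operator `L_f^ω : g ↦ f *_ω g`. -/
def IsLeftConv (μ : Measure G) (ω : 𝒢.Cocycle) (f : 𝒢.L2 μ)
    (T : 𝒢.L2 μ →L[ℂ] 𝒢.L2 μ) : Prop :=
  ∀ g : 𝒢.L2 μ, T g =ᵐ[𝒢.muS μ] conv ω f g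

/-- `T` is the operator `R_f^ω : g ↦ g *_{conj ω} f`. -/
def IsRightConv (μ : Measure G) (ω : 𝒢.Cocycle) (f : 𝒢.L2 μ)
    (T : 𝒢.L2 μ →L[ℂ] 𝒢.L2 μ) : Prop :=
  ∀ g : 𝒢.L2 μ, T g =ᵐ[𝒢.muS μ] conv ω.conj g f

/-- The set `LC_ω(𝒢)` of all `L_f^ω`, for left convolvers `f`. -/
def leftConvolvers (μ : Measure G) (ω : 𝒢.Cocycle) : Set (𝒢.L2 μ →L[ℂ] 𝒢.L2 μ) :=
  {T | ∃ f : 𝒢.L2 μ, IsLeftConvolver μ ω f ∧ IsLeftConv μ ω f T}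

/-- The set `RC_ω(𝒢)` of all `R_f^ω`, for right convolvers `f`. -/
def rightConvolvers (μ : Measure G) (ω : 𝒢.Cocycle) : Set (𝒢.L2 μ →L[ℂ] 𝒢.L2 μ) :=
  {T | ∃ f : 𝒢.L2 μ, IsRightConvolver μ ω f ∧ IsRightConv μ ω f T}

end

end DiscreteBorelGroupoid

open Set Filter Topology

/-! Let ξ be the indicator function of the unit space. The normalization of ω makes ξ act as an
identity when `conv ω` is applied to it and the indicator function of a bisection. Since a factor
taken from a bisection is determined by the product, λ_A is left convolution by 1_A. Likewise ρ_A
for `ω.conj` is right convolution by the indicator of A⁻¹ with respect to ω itself, because the two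
conjugations cancel.

The operators L_f and R_h commute: on the indicator of a bisection E this is f * (1_E * h) = (f *
1_E) * h, where every inner convolution has a single term and only the cocycle identity is needed
(`conv_conv_indicator`, `commute_leftConv_rightConv`). Conversely, if T commutes with the left
translations, then T 1_E = T λ_E ξ = λ_E T ξ = 1_E * Tξ for every bisection E, so T should be R_f
with f = Tξ. The argument for right translations is the mirror image. Hence {λ}' ⊆ RC ⊆ LC' ⊆ {λ}'
and {ρ}' ⊆ LC ⊆ RC' ⊆ {ρ}', and all the equalities follow by taking commutants. No adjoint is ever
needed.

Three analytic facts carry this. Almost all of the groupoid is a countable union of Borel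
bisections; this is a form of the Lusin-Novikov theorem modulo null sets,
`exists_measurable_injOn_cover`. A bounded operator given by a convolution on indicators of small
bisections is given by that convolution, absolutely convergent almost everywhere, on all of L²
(`FiberAE.apply_eq_fiberSum`); in the other direction, boundedness of L_f and R_f comes from the
closed graph theorem. Finally, there are enough bisections with bounded right translation: cut a
bisection along the sublevel sets of a Radon-Nikodym derivative
(`exists_bounded_cover_of_bisection`). -/

/-! ### Universal measurability of analytic sets. -/

/-- Inner approximation of an analytic set by a compact subset. -/
theorem exists_isCompact_subset_range_lt_measure {Y : Type*} [TopologicalSpace Y] [PolishSpace Y]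
    [MeasurableSpace Y] [BorelSpace Y] (μ : Measure Y) [IsFiniteMeasure μ]
    {f : (ℕ → ℕ) → Y} (hf : Continuous f) {r : ℝ≥0∞} (hr : r < μ (range f)) :
    ∃ K ⊆ range f, IsCompact K ∧ r ≤ μ K := by
  -- Bounds on the coordinates are chosen one at a time, each so large that the image keeps measure
  -- above `r`. This is possible because outer measure is continuous along increasing unions of
  -- arbitrary sets. The diagonal `k` of the successive choices bounds a compact box.
  let C : ℕ → (ℕ → ℕ) → Set (ℕ → ℕ) := fun n k => {σ | ∀ i < n, σ i ≤ k i}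
  have step : ∀ n k, ∃ m, r < μ (f '' C n k) → r < μ (f '' C (n + 1) (Function.update k n m)) := by
    intro n k
    by_cases h : r < μ (f '' C n k)
    · have hU : f '' C n k = ⋃ m, f '' C (n + 1) (Function.update k n m) := by
        rw [← image_iUnion]
        congr 1
        ext σ
        simp only [C, mem_ofPred_eq, mem_iUnion]
        constructor
        · intro hσ
          refine ⟨σ n, fun i hi => ?_⟩
          rcases eq_or_ne i n with rfl | hne
          · simp
          · rw [Function.update_of_ne hne]
            exact hσ i (by omega)
        · rintro ⟨m, hm⟩ i hi
          have := hm i (by omega)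
          rwa [Function.update_of_ne (by omega)] at this
      have hmono : Monotone fun m => f '' C (n + 1) (Function.update k n m) := by
        intro a b hab
        refine image_mono fun σ hσ i hi => (hσ i hi).trans ?_
        rcases eq_or_ne i n with rfl | hne
        · simpa using hab
        · simp [Function.update_of_ne hne]
      rw [hU, hmono.measure_iUnion, lt_iSup_iff] at h
      obtain ⟨m, hm⟩ := h
      exact ⟨m, fun _ => hm⟩
    · exact ⟨0, fun h' => absurd h' h⟩
  choose m hm using step
  let S : ℕ → ℕ → ℕ := fun n => Nat.rec (fun _ => 0) (fun j k => Function.update k j (m j k)) n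
  have hS : ∀ n, S (n + 1) = Function.update (S n) n (m n (S n)) := fun n => rfl
  let k : ℕ → ℕ := fun i => S (i + 1) i
  have hSk : ∀ n, ∀ i < n, S n i = k i := by
    intro n
    induction n with
    | zero => intro i hi; omega
    | succ n ih =>
      intro i hi
      rcases eq_or_ne i n with rfl | hne
      · rfl
      · rw [hS, Function.update_of_ne hne]
        exact ih i (by omega)
  have hSr : ∀ n, r < μ (f '' C n (S n)) := by
    intro n
    induction n with
    | zero =>
      have : C 0 (S 0) = univ := by ext; simp [C]
      rwa [this, image_univ]
    | succ n ih => rw [hS]; exact hm n _ ih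
  have hkr : ∀ n, r < μ (f '' C n k) := by
    intro n
    have : C n k = C n (S n) := by
      ext σ
      exact forall₂_congr fun i hi => by rw [hSk n i hi]
    rw [this]
    exact hSr n
  have hK : IsCompact (Set.pi univ fun i => Iic (k i)) :=
    isCompact_univ_pi fun i => (finite_Iic (k i)).isCompact
  refine ⟨f '' (Set.pi univ fun i => Iic (k i)), image_subset_range _ _, hK.image hf, ?_⟩
  -- By outer regularity it suffices that every open set containing the image of the box contains
  -- the image of some `C n k`, whose measure exceeds `r`.
  rw [Set.measure_eq_iInf_isOpen]
  refine le_iInf₂ fun O hO => le_iInf fun hOo => ?_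
  have hW : IsOpen (f ⁻¹' O) := hOo.preimage hf
  have hKW : (Set.pi univ fun i => Iic (k i)) ⊆ f ⁻¹' O := image_subset_iff.1 hO
  have : ∃ n, C n k ⊆ f ⁻¹' O := by
    by_contra! hcon
    have : ∀ n, ∃ σ ∈ C n k, σ ∉ f ⁻¹' O := fun n => not_subset.1 (hcon n)
    choose σ hσC hσO using this
    -- Truncation moves `σ n` into the compact box and does not change its first `n` coordinates, so
    -- a convergent subsequence of the truncations has the same limit as that of the original
    -- points.
    let τ : ℕ → ℕ → ℕ := fun n i => min (σ n i) (k i)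
    obtain ⟨x, hx, φ, hφ, hlim⟩ := hK.tendsto_subseq (x := τ)
      fun n i _ => mem_Iic.2 (min_le_right _ _)
    have hlim' : Tendsto (σ ∘ φ) atTop (𝓝 x) := by
      rw [tendsto_pi_nhds] at hlim ⊢
      intro i
      refine (hlim i).congr' ?_
      filter_upwards [eventually_gt_atTop i] with j hj
      exact min_eq_left (hσC (φ j) i (hj.trans_le hφ.le_apply))
    obtain ⟨j, hj⟩ := (hlim'.eventually (hW.mem_nhds (hKW hx))).exists
    exact hσO _ hj
  obtain ⟨n, hn⟩ := this
  exact (hkr n).le.trans (measure_mono (image_subset_iff.2 hn))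

/-- Analytic sets are measurable for the completion of every finite Borel measure. -/
theorem MeasureTheory.AnalyticSet.nullMeasurableSet {Y : Type*} [TopologicalSpace Y] [PolishSpace Y]
    [MeasurableSpace Y] [BorelSpace Y] (μ : Measure Y) [IsFiniteMeasure μ] {A : Set Y}
    (hA : AnalyticSet A) : NullMeasurableSet A μ := by
  rw [AnalyticSet] at hA
  rcases hA with rfl | ⟨f, hf, rfl⟩
  · exact nullMeasurableSet_empty
  rcases eq_or_ne (μ (range f)) 0 with h0 | h0
  · exact NullMeasurableSet.of_null h0
  -- Compact subsets with measures tending to that of the analytic set exhaust it up to a null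
  -- subset of its measurable hull.
  obtain ⟨u, -, hu, hulim⟩ := exists_seq_strictMono_tendsto' (pos_iff_ne_zero.2 h0)
  choose K hKs hKc hKr using fun n => exists_isCompact_subset_range_lt_measure μ hf (hu n).2
  have hsub : ⋃ n, K n ⊆ range f := iUnion_subset hKs
  have hm : MeasurableSet (⋃ n, K n) := MeasurableSet.iUnion fun n => (hKc n).measurableSet
  have hge : μ (range f) ≤ μ (⋃ n, K n) :=
    le_of_tendsto' hulim fun n => (hKr n).trans (measure_mono (subset_iUnion K n))
  have h1 : (⋃ n, K n) =ᵐ[μ] toMeasurable μ (range f) :=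
    ae_eq_of_subset_of_measure_ge (hsub.trans (subset_toMeasurable _ _))
      (by rwa [measure_toMeasurable]) hm.nullMeasurableSet (measure_ne_top _ _)
  refine ⟨⋃ n, K n, hm, ?_⟩
  refine Filter.EventuallyEq.symm (LE.le.eventuallyLE hsub |>.antisymm ?_)
  exact (LE.le.eventuallyLE (subset_toMeasurable μ (range f))).trans h1.symm.le

/-! ### The Lusin-Novikov theorem modulo null sets. -/

/-- `A` is covered, up to the preimage of a null set, by countably many Borel sets on which `f` is
injective. -/
def AESigmaInjOn {X Y : Type*} [MeasurableSpace X] [MeasurableSpace Y] (f : X → Y) (μ : Measure Y)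
    (A : Set X) : Prop :=
  ∃ N, MeasurableSet N ∧ μ N = 0 ∧ ∃ 𝒮 : Set (Set X), 𝒮.Countable ∧
    (∀ S ∈ 𝒮, MeasurableSet S ∧ InjOn f S) ∧ A ⊆ f ⁻¹' N ∪ ⋃₀ 𝒮

namespace AESigmaInjOn

variable {X Y : Type*} [MeasurableSpace X] [MeasurableSpace Y] {f : X → Y} {μ : Measure Y}

theorem mono {A B : Set X} (h : AESigmaInjOn f μ B) (hAB : A ⊆ B) : AESigmaInjOn f μ A := by
  obtain ⟨N, hN, hN0, 𝒮, hc, hS, hsub⟩ := h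
  exact ⟨N, hN, hN0, 𝒮, hc, hS, hAB.trans hsub⟩

theorem iUnion {ι : Type*} [Countable ι] {A : ι → Set X} (h : ∀ i, AESigmaInjOn f μ (A i)) :
    AESigmaInjOn f μ (⋃ i, A i) := by
  choose N hN hN0 𝒮 hc hS hsub using h
  refine ⟨⋃ i, N i, MeasurableSet.iUnion hN, measure_iUnion_null hN0, ⋃ i, 𝒮 i,
    countable_iUnion hc, ?_, ?_⟩
  · intro S hS'
    obtain ⟨i, hi⟩ := mem_iUnion.1 hS'
    exact hS i S hi
  · refine iUnion_subset fun i x hx => ?_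
    rcases hsub i hx with h | ⟨S, hS', hxS⟩
    · exact Or.inl (mem_iUnion.2 ⟨i, h⟩)
    · exact Or.inr ⟨S, mem_iUnion.2 ⟨i, hS'⟩, hxS⟩

theorem union {A B : Set X} (hA : AESigmaInjOn f μ A) (hB : AESigmaInjOn f μ B) :
    AESigmaInjOn f μ (A ∪ B) := by
  rw [union_eq_iUnion]
  exact iUnion fun b => by cases b <;> assumption

theorem of_injOn {A : Set X} (hA : MeasurableSet A) (hf : InjOn f A) : AESigmaInjOn f μ A :=
  ⟨∅, MeasurableSet.empty, measure_empty, {A}, countable_singleton A,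
    fun S hS => by rw [mem_singleton_iff.1 hS]; exact ⟨hA, hf⟩, by simp⟩

theorem of_preimage_null {N : Set Y} (hN : μ N = 0) : AESigmaInjOn f μ (f ⁻¹' N) :=
  ⟨toMeasurable μ N, measurableSet_toMeasurable _ _, by rwa [measure_toMeasurable], ∅,
    countable_empty, by simp, by
      rw [sUnion_empty, union_empty]; exact preimage_mono (subset_toMeasurable _ _)⟩

theorem empty : AESigmaInjOn f μ ∅ := of_injOn MeasurableSet.empty (injOn_empty _)

end AESigmaInjOn

/-- A nonempty countable closed set in a Polish space has an isolated point. -/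
theorem IsClosed.exists_isolated_of_countable {X : Type*} [TopologicalSpace X] [PolishSpace X]
    {C : Set X} (hC : IsClosed C) (hcount : C.Countable) (hne : C.Nonempty) :
    ∃ x ∈ C, ∃ U ∈ 𝓝 x, ∀ y ∈ U ∩ C, y = x := by
  by_contra! hcon
  let := TopologicalSpace.upgradeIsCompletelyMetrizable X
  -- Without isolated points the set would be perfect and so contain a copy of the uncountable
  -- Cantor space.
  have hperf : Perfect C := ⟨hC, preperfect_iff_nhds.2 hcon⟩
  obtain ⟨g, hg, -, hinj⟩ := hperf.exists_nat_bool_injection hne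
  have hr : (range g).Countable := hcount.mono hg
  have : Countable (ℕ → Bool) := by
    have := hr.to_subtype
    exact (rangeFactorization_injective.2 hinj).countable
  exact (Cardinal.mk_le_aleph0 (α := ℕ → Bool)).not_gt (by
    rw [← Cardinal.power_def]; simpa using Cardinal.cantor Cardinal.aleph0)

/-- Lusin-Novikov up to a null set, for continuous maps. -/
theorem aesigmaInjOn_univ_of_continuous {X Y : Type*} [TopologicalSpace X] [PolishSpace X]
    [MeasurableSpace X] [BorelSpace X] [TopologicalSpace Y] [PolishSpace Y] [MeasurableSpace Y]
    [BorelSpace Y] {f : X → Y} (hf : Continuous f) (hcount : ∀ y, (f ⁻¹' {y}).Countable)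
    (μ : Measure Y) [IsFiniteMeasure μ] : AESigmaInjOn f μ univ := by
  let ι := TopologicalSpace.countableBasis X
  have : Countable ι := (TopologicalSpace.countable_countableBasis X).to_subtype
  have hbasis := TopologicalSpace.isBasis_countableBasis X
  -- The candidates for what is left after removing countably many pieces on which `f` is injective.
  -- Closed fibres are kept so that a nonempty countable fibre has an isolated point.
  let 𝓕 : Set (Set X) :=
    {F | MeasurableSet F ∧ (∀ y, IsClosed (F ∩ f ⁻¹' {y})) ∧ AESigmaInjOn f μ Fᶜ}
  have huniv : univ ∈ 𝓕 := by
    refine ⟨MeasurableSet.univ, fun y => ?_, ?_⟩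
    · rw [univ_inter]; exact isClosed_singleton.preimage hf
    · rw [compl_univ]; exact AESigmaInjOn.empty
  -- The family is stable under countable intersections, so intersecting minimizing sequences for
  -- all basic open `U` gives one set that minimizes all these measures simultaneously.
  have hmin : ∃ F ∈ 𝓕, ∀ F' ∈ 𝓕, ∀ U : ι, μ (f '' (F ∩ U)) ≤ μ (f '' (F' ∩ U)) := by
    have h1 : ∀ U : ι, ∃ F : ℕ → Set X, (∀ n, F n ∈ 𝓕) ∧ ∀ F' ∈ 𝓕, ∀ A : Set X,
        (∀ n, A ⊆ F n) → μ (f '' (A ∩ U)) ≤ μ (f '' (F' ∩ U)) := by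
      intro U
      obtain ⟨u, -, hu, hmem⟩ := exists_seq_tendsto_sInf
        (S := (fun F : Set X => μ (f '' (F ∩ U))) '' 𝓕) ⟨_, mem_image_of_mem _ huniv⟩
        (OrderBot.bddBelow _)
      choose F hF hFu using hmem
      refine ⟨F, hF, fun F' hF' A hA => ?_⟩
      refine le_trans (ge_of_tendsto' hu fun n => ?_) (sInf_le (mem_image_of_mem _ hF'))
      rw [← hFu n]
      exact measure_mono (image_mono (inter_subset_inter_left _ (hA n)))
    choose F hF hFm using h1
    rcases isEmpty_or_nonempty ι with hι | hι
    · exact ⟨univ, huniv, fun F' _ U => hι.elim U⟩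
    · refine ⟨⋂ k : ι × ℕ, F k.1 k.2, ⟨MeasurableSet.iInter fun k => (hF k.1 k.2).1, fun y => ?_, ?_⟩,
        fun F' hF' U => hFm U F' hF' _ fun n => iInter_subset (fun k : ι × ℕ => F k.1 k.2) (U, n)⟩
      · rw [iInter_inter]
        exact isClosed_iInter fun k => (hF k.1 k.2).2.1 y
      · rw [compl_iInter]
        exact AESigmaInjOn.iUnion fun k => (hF k.1 k.2).2.2
  obtain ⟨F, ⟨hFm, hFc, hFs⟩, hFmin⟩ := hmin
  have hUo : ∀ U : ι, IsOpen (U : Set X) := fun U => hbasis.isOpen U.2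
  -- `D U` is the set of points whose fibre in `F ∩ U` has at least two elements.
  let W : ι → Set (X × X) := fun U => {p | p.1 ∈ F ∩ U ∧ p.2 ∈ F ∩ U ∧ p.1 ≠ p.2 ∧ f p.1 = f p.2}
  let D : ι → Set Y := fun U => (fun p : X × X => f p.1) '' W U
  have hWm : ∀ U, MeasurableSet (W U) := by
    intro U
    have hFU := hFm.inter (hUo U).measurableSet
    refine (measurable_fst hFU).inter ((measurable_snd hFU).inter (MeasurableSet.inter ?_ ?_))
    · exact (measurableSet_eq_fun measurable_fst measurable_snd).compl
    · exact measurableSet_eq_fun (hf.measurable.comp measurable_fst)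
        (hf.measurable.comp measurable_snd)
  have hDnull : ∀ U, NullMeasurableSet (D U) μ := fun U =>
    ((hWm U).analyticSet_image (hf.measurable.comp measurable_fst)).nullMeasurableSet μ
  -- Over `Q U` the fibres of `F ∩ U` have at most one point. The hull replaces the analytic set `D
  -- U` in order to make `Q U` Borel, at the cost of a null set. The pieces `I U` consist of
  -- isolated points of fibres and are removed next.
  let Q : ι → Set Y := fun U => (toMeasurable μ (D U))ᶜ
  let I : ι → Set X := fun U => F ∩ U ∩ f ⁻¹' Q U
  have hIm : ∀ U, MeasurableSet (I U) := fun U =>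
    (hFm.inter (hUo U).measurableSet).inter
      (hf.measurable (measurableSet_toMeasurable _ _).compl)
  have hIinj : ∀ U, InjOn f (I U) := by
    intro U x hx x' hx' hxx'
    by_contra hne
    exact hx.2 (subset_toMeasurable _ _ ⟨(x, x'), ⟨hx.1, hx'.1, hne, hxx'⟩, rfl⟩)
  have hF' : F \ ⋃ U, I U ∈ 𝓕 := by
    refine ⟨hFm.diff (MeasurableSet.iUnion hIm), fun y => ?_, ?_⟩
    · have : (F \ ⋃ U, I U) ∩ f ⁻¹' {y} =
          (F ∩ f ⁻¹' {y}) ∩ (⋃ U ∈ {U : ι | y ∈ Q U}, (U : Set X))ᶜ := by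
        ext x
        constructor
        · rintro ⟨⟨hxF, hxI⟩, hxy⟩
          refine ⟨⟨hxF, hxy⟩, fun hx => hxI ?_⟩
          obtain ⟨U, hU, hxU⟩ := mem_iUnion₂.1 hx
          refine mem_iUnion.2 ⟨U, ⟨hxF, hxU⟩, ?_⟩
          rw [mem_preimage, mem_singleton_iff.1 hxy]
          exact hU
        · rintro ⟨⟨hxF, hxy⟩, hx⟩
          refine ⟨⟨hxF, fun hxI => hx ?_⟩, hxy⟩
          obtain ⟨U, hU⟩ := mem_iUnion.1 hxI
          refine mem_iUnion₂.2 ⟨U, ?_, hU.1.2⟩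
          have := hU.2
          rw [mem_preimage, mem_singleton_iff.1 hxy] at this
          exact this
      rw [this]
      exact (hFc y).inter (isOpen_biUnion fun U _ => hUo U).isClosed_compl
    · have : (F \ ⋃ U, I U)ᶜ ⊆ Fᶜ ∪ ⋃ U, I U := by
        intro x hx
        by_cases hxF : x ∈ F
        · right
          by_contra h
          exact hx ⟨hxF, h⟩
        · exact Or.inl hxF
      exact (hFs.union (AESigmaInjOn.iUnion fun U => AESigmaInjOn.of_injOn (hIm U) (hIinj U))).mono
        this
  -- By minimality, removing the pieces `I U` shrinks no image `f '' (F ∩ U)` by more than a null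
  -- set.
  have hae1 : ∀ᵐ y ∂μ, ∀ U : ι, y ∈ f '' (F ∩ U) → y ∈ f '' ((F \ ⋃ U, I U) ∩ U) := by
    rw [ae_all_iff]
    intro U
    have hnm : NullMeasurableSet (f '' ((F \ ⋃ U, I U) ∩ U)) μ :=
      ((hF'.1.inter (hUo U).measurableSet).analyticSet_image hf.measurable).nullMeasurableSet μ
    have := ae_eq_of_subset_of_measure_ge (μ := μ)
      (image_mono (f := f) (inter_subset_inter_left (U : Set X) sdiff_subset)) (hFmin _ hF' U) hnm
      (measure_ne_top _ _)
    filter_upwards [this.mem_iff] with y hy using hy.2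
  have hae2 : ∀ᵐ y ∂μ, ∀ U : ι, y ∉ D U → y ∈ Q U := by
    rw [ae_all_iff]
    intro U
    filter_upwards [(hDnull U).toMeasurable_ae_eq.mem_iff] with y hy hyD
    exact fun h => hyD (hy.1 h)
  -- An isolated point of a fibre lies in some `I U` and is the only point of its fibre in `F ∩ U`.
  -- Its removal would take `y` out of the image, against `hae1`. Thus almost every fibre of the
  -- minimal set is empty.
  have hae : ∀ᵐ y ∂μ, F ∩ f ⁻¹' {y} = ∅ := by
    filter_upwards [hae1, hae2] with y hy1 hy2
    by_contra hne
    obtain ⟨x, hxF, V, hV, hVx⟩ := (hFc y).exists_isolated_of_countable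
      ((hcount y).mono inter_subset_right) (nonempty_iff_ne_empty.2 hne)
    obtain ⟨U, hU, hxU, hUV⟩ := hbasis.mem_nhds_iff.1 hV
    have hxy : f x = y := hxF.2
    have honly : ∀ z ∈ F ∩ U, f z = y → z = x := fun z hz hzy => hVx z ⟨hUV hz.2, hz.1, hzy⟩
    have hyQ : y ∈ Q ⟨U, hU⟩ := by
      apply hy2
      rintro ⟨p, ⟨h1, h2, h3, h4⟩, h5⟩
      exact h3 ((honly _ h1 h5).trans (honly _ h2 (h4.symm.trans h5)).symm)
    obtain ⟨z, ⟨⟨hzF, hzI⟩, hzU⟩, hzy⟩ := hy1 ⟨U, hU⟩ ⟨x, ⟨hxF.1, hxU⟩, hxy⟩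
    refine hzI (mem_iUnion.2 ⟨⟨U, hU⟩, ⟨hzF, hzU⟩, ?_⟩)
    rw [mem_preimage, hzy]
    exact hyQ
  have hFsmall : AESigmaInjOn f μ F := by
    refine (AESigmaInjOn.of_preimage_null (μ := μ) (N := {y | ¬ (F ∩ f ⁻¹' {y} = ∅)})
      (ae_iff.1 hae)).mono fun x hx h => ?_
    have : x ∈ F ∩ f ⁻¹' {f x} := ⟨hx, rfl⟩
    rw [h] at this
    exact this
  rw [← union_compl_self F]
  exact hFsmall.union hFs

/-- Lusin-Novikov up to a null set: a countable-to-one Borel map between standard Borel spaces is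
injective on each of countably many Borel sets covering the preimage of a conull set. -/
theorem exists_measurable_injOn_cover {X Y : Type*} [MeasurableSpace X] [StandardBorelSpace X]
    [MeasurableSpace Y] [StandardBorelSpace Y] {f : X → Y} (hf : Measurable f)
    (hcount : ∀ y, (f ⁻¹' {y}).Countable) (μ : Measure Y) [IsFiniteMeasure μ] :
    ∃ N : Set Y, MeasurableSet N ∧ μ N = 0 ∧ ∃ S : ℕ → Set X, (∀ n, MeasurableSet (S n)) ∧
      (∀ n, InjOn f (S n)) ∧ Pairwise (Function.onFun Disjoint S) ∧ ∀ x, f x ∉ N → ∃ n, x ∈ S n := by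
  have key : AESigmaInjOn f μ univ := by
    obtain ⟨tX, hbX, hpX⟩ := StandardBorelSpace.polish (α := X)
    obtain ⟨tY, hbY, hpY⟩ := StandardBorelSpace.polish (α := Y)
    -- A finer Polish topology with the same Borel sets makes `f` continuous.
    obtain ⟨t', hle, hcont, hp'⟩ := hf.exists_continuous
    have hb' : @BorelSpace X t' _ :=
      @BorelSpace.mk X t' _ (hbX.measurable_eq.trans (borel_eq_borel_of_le hp' hpX hle).symm)
    exact @aesigmaInjOn_univ_of_continuous X Y t' hp' _ hb' _ _ _ _ f hcont hcount μ _
  obtain ⟨N, hN, hN0, 𝒮, hc, hS, hsub⟩ := key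
  obtain ⟨S, hSr⟩ := (hc.insert ∅).exists_eq_range (insert_nonempty _ _)
  have hS' : ∀ n, MeasurableSet (S n) ∧ InjOn f (S n) := by
    intro n
    have : S n ∈ insert ∅ 𝒮 := by rw [hSr]; exact mem_range_self n
    rcases this with h | h
    · rw [h]; exact ⟨MeasurableSet.empty, injOn_empty _⟩
    · exact hS _ h
  refine ⟨N, hN, hN0, disjointed S, fun n => MeasurableSet.disjointed (fun n => (hS' n).1) n,
    fun n => (hS' n).2.mono (disjointed_subset S n), disjoint_disjointed S, fun x hx => ?_⟩
  rcases hsub (mem_univ x) with h | ⟨T, hT, hxT⟩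
  · exact absurd h hx
  · have : T ∈ range S := by rw [← hSr]; exact mem_insert_of_mem _ hT
    obtain ⟨n, rfl⟩ := this
    have : x ∈ ⋃ n, disjointed S n := by rw [iUnion_disjointed]; exact mem_iUnion.2 ⟨n, hxT⟩
    exact mem_iUnion.1 this

/-! ### Integrating the counting measures of the fibres. -/

section FiberCount

variable {X Y : Type*} [MeasurableSpace X] [StandardBorelSpace X] [MeasurableSpace Y]
  [StandardBorelSpace Y] {f : X → Y} {μ : Measure Y} [IsFiniteMeasure μ]

/-- Off a null set, counting a fibre of `A` amounts to summing the indicators of the images `f '' (A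
∩ S n)` of disjoint pieces on which `f` is injective; these images are Borel by the Lusin-Souslin
theorem. This is what gives the `bind` in `muS` and `muT` its intended values. -/
theorem aemeasurable_count_restrict_fiber (hf : Measurable f)
    (hcount : ∀ y, (f ⁻¹' {y}).Countable) :
    AEMeasurable (fun y => Measure.count.restrict (f ⁻¹' {y})) μ := by
  classical
  obtain ⟨N, hN, hN0, S, hSm, hSi, hSd, hcov⟩ := exists_measurable_injOn_cover hf hcount μ
  let κ : Y → Measure X := fun y => Measure.sum fun n => Measure.count.restrict (f ⁻¹' {y} ∩ S n)
  have hfy : ∀ y, MeasurableSet (f ⁻¹' {y}) := fun y => hf (measurableSet_singleton y)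
  refine ⟨κ, Measure.measurable_of_measurable_coe _ fun A hA => ?_, ?_⟩
  · have : (fun y => κ y A) = fun y => ∑' n, (f '' (A ∩ S n)).indicator (fun _ => 1) y := by
      ext y
      simp only [κ]
      rw [Measure.sum_apply _ hA]
      refine tsum_congr fun n => ?_
      rw [Measure.restrict_apply hA]
      by_cases hy : y ∈ f '' (A ∩ S n)
      · obtain ⟨x, hx, rfl⟩ := hy
        have : A ∩ (f ⁻¹' {f x} ∩ S n) = {x} := by
          ext z
          constructor
          · rintro ⟨hzA, hzf, hzS⟩
            exact hSi n hzS hx.2 hzf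
          · rintro rfl
            exact ⟨hx.1, rfl, hx.2⟩
        rw [this, Measure.count_singleton, indicator_of_mem (mem_image_of_mem f hx)]
      · have : A ∩ (f ⁻¹' {y} ∩ S n) = ∅ := by
          ext z
          simp only [mem_inter_iff, mem_preimage, mem_singleton_iff, mem_empty_iff_false, iff_false]
          rintro ⟨hzA, hzf, hzS⟩
          exact hy ⟨z, ⟨hzA, hzS⟩, hzf⟩
        rw [this, measure_empty, indicator_of_notMem hy]
    rw [this]
    refine Measurable.tsum fun n => measurable_const.indicator ?_
    exact (hA.inter (hSm n)).image_of_measurable_injOn hf ((hSi n).mono inter_subset_right)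
  · have hNae : ∀ᵐ y ∂μ, y ∉ N := measure_eq_zero_iff_ae_notMem.1 hN0
    filter_upwards [hNae] with y hy
    simp only [κ]
    rw [← Measure.restrict_iUnion
      (fun i j hij => (hSd hij).mono inter_subset_right inter_subset_right)
      fun n => (hfy y).inter (hSm n), ← inter_iUnion]
    congr 1
    refine (inter_eq_left.2 fun x hx => ?_).symm
    rw [mem_preimage, mem_singleton_iff] at hx
    exact mem_iUnion.2 (hcov x (by rwa [hx]))

theorem bind_count_fiber_apply (hf : Measurable f) (hcount : ∀ y, (f ⁻¹' {y}).Countable)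
    {A : Set X} (hA : MeasurableSet A) :
    μ.bind (fun y => Measure.count.restrict (f ⁻¹' {y})) A =
      ∫⁻ y, Measure.count (A ∩ f ⁻¹' {y}) ∂μ := by
  rw [Measure.bind_apply hA (aemeasurable_count_restrict_fiber hf hcount)]
  exact lintegral_congr fun y => Measure.restrict_apply hA

/-- Nonempty sets have positive counting measure, so a set is null exactly when almost every fibre
misses it altogether. -/
theorem ae_bind_count_fiber_iff (hf : Measurable f) (hcount : ∀ y, (f ⁻¹' {y}).Countable)
    {P : X → Prop} :
    (∀ᵐ x ∂(μ.bind fun y => Measure.count.restrict (f ⁻¹' {y})), P x) ↔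
      ∀ᵐ y ∂μ, ∀ x, f x = y → P x := by
  constructor
  · intro h
    filter_upwards [Measure.ae_ae_of_ae_bind (aemeasurable_count_restrict_fiber hf hcount) h]
      with y hy x hx
    rw [ae_restrict_iff' (hf (measurableSet_singleton y)), Measure.ae_count_iff] at hy
    exact hy x hx
  · intro h
    obtain ⟨M, hsub, hM, hM0⟩ := exists_measurable_superset_of_null (ae_iff.1 h)
    have h0 : μ.bind (fun y => Measure.count.restrict (f ⁻¹' {y})) (f ⁻¹' M) = 0 := by
      rw [bind_count_fiber_apply hf hcount (hf hM), lintegral_eq_zero_iff']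
      · filter_upwards [measure_eq_zero_iff_ae_notMem.1 hM0] with y hy
        have : f ⁻¹' M ∩ f ⁻¹' {y} = ∅ := by
          rw [← preimage_inter, inter_singleton_eq_empty.2 hy, preimage_empty]
        rw [this, measure_empty, Pi.zero_apply]
      · have := (aemeasurable_count_restrict_fiber (μ := μ) hf hcount)
        refine ((Measure.measurable_coe (hf hM)).comp_aemeasurable this).congr ?_
        exact Eventually.of_forall fun y => Measure.restrict_apply (hf hM)
    refine measure_mono_null (fun x hx => ?_) h0
    exact hsub fun h' => hx (h' x rfl)

theorem bind_count_fiber_le_of_injOn (hf : Measurable f) (hcount : ∀ y, (f ⁻¹' {y}).Countable)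
    {A : Set X} (hA : MeasurableSet A) (hinj : InjOn f A) :
    μ.bind (fun y => Measure.count.restrict (f ⁻¹' {y})) A ≤ μ univ := by
  rw [bind_count_fiber_apply hf hcount hA, ← lintegral_one]
  refine lintegral_mono fun y => ?_
  have hs : (A ∩ f ⁻¹' {y}).Subsingleton := fun x hx z hz =>
    hinj hx.1 hz.1 ((mem_singleton_iff.1 hx.2).trans (mem_singleton_iff.1 hz.2).symm)
  rcases hs.eq_empty_or_singleton with h | ⟨x, h⟩
  · rw [h, measure_empty]; exact zero_le
  · rw [h, Measure.count_singleton]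

end FiberCount

/-! ### Null sets and bisections of a measured groupoid. -/

namespace DiscreteBorelGroupoid

variable {G : Type*} [MeasurableSpace G] {𝒢 : DiscreteBorelGroupoid G} {μ : Measure G}

theorem IsMeasured.ae_muS_iff_ae_muT (hμ : 𝒢.IsMeasured μ) {P : G → Prop} :
    (∀ᵐ x ∂(𝒢.muS μ), P x) ↔ ∀ᵐ x ∂(𝒢.muT μ), P x :=
  ⟨fun h => hμ.muT_ac_muS.ae_le h, fun h => hμ.muS_ac_muT.ae_le h⟩

theorem IsBorelBisection.mono {A B : Set G} (hA : 𝒢.IsBorelBisection A) (hBA : B ⊆ A)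
    (hB : MeasurableSet B) : 𝒢.IsBorelBisection B :=
  ⟨hB, hA.injOn_src.mono hBA, hA.injOn_tgt.mono hBA⟩

variable [StandardBorelSpace G]

theorem IsMeasured.ae_muS_iff (hμ : 𝒢.IsMeasured μ) {P : G → Prop} :
    (∀ᵐ x ∂(𝒢.muS μ), P x) ↔ ∀ᵐ y ∂μ, ∀ x, 𝒢.src x = y → P x :=
  have := hμ.isProbabilityMeasure
  ae_bind_count_fiber_iff 𝒢.measurable_src 𝒢.countable_src_fiber

theorem IsMeasured.ae_muT_iff (hμ : 𝒢.IsMeasured μ) {P : G → Prop} :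
    (∀ᵐ x ∂(𝒢.muT μ), P x) ↔ ∀ᵐ y ∂μ, ∀ x, 𝒢.tgt x = y → P x :=
  have := hμ.isProbabilityMeasure
  ae_bind_count_fiber_iff 𝒢.measurable_tgt 𝒢.countable_tgt_fiber

/-- Almost everywhere properties hold on the whole source fibre of almost every arrow. -/
theorem IsMeasured.ae_src (hμ : 𝒢.IsMeasured μ) {P : G → Prop} (h : ∀ᵐ x ∂(𝒢.muS μ), P x) :
    ∀ᵐ x ∂(𝒢.muS μ), ∀ b, 𝒢.src b = 𝒢.src x → P b := by
  rw [hμ.ae_muS_iff] at h ⊢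
  filter_upwards [h] with y hy x hx b hb using hy b (hb.trans hx)

/-- Almost everywhere properties hold on the whole target fibre of almost every arrow. -/
theorem IsMeasured.ae_tgt (hμ : 𝒢.IsMeasured μ) {P : G → Prop} (h : ∀ᵐ x ∂(𝒢.muS μ), P x) :
    ∀ᵐ x ∂(𝒢.muS μ), ∀ a, 𝒢.tgt a = 𝒢.tgt x → P a := by
  -- Non-singularity enters here: null sets for μ_s are those for μ_t, and the latter are governed
  -- by the target fibres.
  rw [hμ.ae_muS_iff_ae_muT, hμ.ae_muT_iff] at h ⊢
  filter_upwards [h] with y hy x hx b hb using hy b (hb.trans hx)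

theorem IsMeasured.muS_le_one (hμ : 𝒢.IsMeasured μ) {A : Set G} (hA : MeasurableSet A)
    (hinj : InjOn 𝒢.src A) : 𝒢.muS μ A ≤ 1 := by
  have := hμ.isProbabilityMeasure
  rw [← measure_univ (μ := μ)]
  exact bind_count_fiber_le_of_injOn 𝒢.measurable_src 𝒢.countable_src_fiber hA hinj

theorem IsBorelBisection.muS_ne_top (hμ : 𝒢.IsMeasured μ) {A : Set G}
    (hA : 𝒢.IsBorelBisection A) : 𝒢.muS μ A ≠ ∞ :=
  ne_top_of_le_ne_top ENNReal.one_ne_top (hμ.muS_le_one hA.measurableSet hA.injOn_src)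

/-- Almost all of the groupoid is a countable union of Borel bisections. -/
theorem IsMeasured.exists_bisection_cover (hμ : 𝒢.IsMeasured μ) :
    ∃ B : ℕ → Set G, (∀ n, 𝒢.IsBorelBisection (B n)) ∧ ∀ᵐ x ∂(𝒢.muS μ), ∃ n, x ∈ B n := by
  have := hμ.isProbabilityMeasure
  obtain ⟨N, hN, hN0, S, hSm, hSi, -, hcov⟩ :=
    exists_measurable_injOn_cover 𝒢.measurable_src 𝒢.countable_src_fiber μ
  obtain ⟨N', hN', hN0', S', hSm', hSi', -, hcov'⟩ :=
    exists_measurable_injOn_cover 𝒢.measurable_tgt 𝒢.countable_tgt_fiber μ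
  refine ⟨fun n => S n.unpair.1 ∩ S' n.unpair.2, fun n => ⟨(hSm _).inter (hSm' _),
    (hSi _).mono inter_subset_left, (hSi' _).mono inter_subset_right⟩, ?_⟩
  have h1 : ∀ᵐ x ∂(𝒢.muS μ), 𝒢.src x ∉ N := by
    rw [hμ.ae_muS_iff]
    filter_upwards [measure_eq_zero_iff_ae_notMem.1 hN0] with y hy x hx
    rwa [hx]
  have h2 : ∀ᵐ x ∂(𝒢.muS μ), 𝒢.tgt x ∉ N' := by
    rw [hμ.ae_muS_iff_ae_muT, hμ.ae_muT_iff]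
    filter_upwards [measure_eq_zero_iff_ae_notMem.1 hN0'] with y hy x hx
    rwa [hx]
  filter_upwards [h1, h2] with x hx1 hx2
  obtain ⟨n, hn⟩ := hcov x hx1
  obtain ⟨m, hm⟩ := hcov' x hx2
  refine ⟨Nat.pair n m, ?_⟩
  simpa using ⟨hn, hm⟩

end DiscreteBorelGroupoid

/-! ### Subsequences, truncations and extensionality in L². -/

section LpTools

variable {X : Type*} [MeasurableSpace X] {m : Measure X}

/-- A convergent sequence in `L²` has a subsequence converging almost everywhere. -/
theorem Lp_exists_subseq_tendsto_ae {u : ℕ → Lp ℂ 2 m} {g : Lp ℂ 2 m}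
    (h : Tendsto u atTop (𝓝 g)) :
    ∃ φ : ℕ → ℕ, StrictMono φ ∧ ∀ᵐ x ∂m, Tendsto (fun n => u (φ n) x) atTop (𝓝 (g x)) :=
  (tendstoInMeasure_of_tendsto_Lp h).exists_seq_tendsto_ae

/-- A convergent sequence in `L²` has a subsequence that converges almost everywhere and is
dominated by an `L²` function. -/
theorem Lp_exists_subseq_dominated {u : ℕ → Lp ℂ 2 m} {g : Lp ℂ 2 m}
    (h : Tendsto u atTop (𝓝 g)) :
    ∃ φ : ℕ → ℕ, StrictMono φ ∧ ∃ H : Lp ℂ 2 m, (∀ᵐ x ∂m, ∀ n, ‖u (φ n) x - g x‖ ≤ ‖H x‖) ∧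
      ∀ᵐ x ∂m, Tendsto (fun n => u (φ n) x) atTop (𝓝 (g x)) := by
  have hlim : Tendsto (fun n => ‖u n - g‖) atTop (𝓝 0) := tendsto_iff_norm_sub_tendsto_zero.1 h
  -- With geometrically small norms, the sum of the absolute differences converges in L² and
  -- dominates each of them.
  obtain ⟨φ, hφ, hφs⟩ := extraction_forall_of_eventually' (P := fun n i => ‖u i - g‖ ≤ (1 / 2) ^ n)
    (fun n => by
      exact eventually_atTop.1
        (hlim.eventually_le_const (by positivity : (0 : ℝ) < (1 / 2) ^ n)))
  have hmem : ∀ n, MemLp (fun x => ((‖(u (φ n) - g) x‖ : ℝ) : ℂ)) 2 m := fun n =>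
    ((Lp.memLp (u (φ n) - g)).norm).ofReal
  let v : ℕ → Lp ℂ 2 m := fun n => (hmem n).toLp _
  have hv : ∀ n, ‖v n‖ ≤ (1 / 2) ^ n := fun n => by
    refine le_trans (Lp.norm_le_norm_of_ae_le ?_) (hφs n)
    filter_upwards [(hmem n).coeFn_toLp] with x hx
    rw [hx]; simp
  have hsum : Summable fun n => ‖v n‖ :=
    Summable.of_nonneg_of_le (fun _ => norm_nonneg _) hv summable_geometric_two
  have hsum' : ∑' n, ‖v n‖ₑ ≠ ∞ := tsum_enorm_ne_top_iff_summable_norm.2 hsum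
  have hae := Lp.hasSum_coeFn_tsum hsum'
  have hvx : ∀ᵐ x ∂m, ∀ n, v n x = ((‖u (φ n) x - g x‖ : ℝ) : ℂ) := by
    rw [ae_all_iff]
    intro n
    filter_upwards [(hmem n).coeFn_toLp, Lp.coeFn_sub (u (φ n)) g] with x hx hx'
    rw [hx, hx', Pi.sub_apply]
  have hre : ∀ᵐ x ∂m, HasSum (fun n => ‖u (φ n) x - g x‖) (((∑' n, v n : Lp ℂ 2 m) x).re) := by
    filter_upwards [hae, hvx] with x hx hx'
    have := Complex.hasSum_re hx
    simpa only [hx', Complex.ofReal_re] using this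
  refine ⟨φ, hφ, ∑' n, v n, ?_, ?_⟩
  · filter_upwards [hre] with x hx n
    refine (le_hasSum hx n fun _ _ => norm_nonneg _).trans ?_
    exact (le_abs_self _).trans (Complex.abs_re_le_norm _)
  · filter_upwards [hre] with x hx
    exact tendsto_iff_norm_sub_tendsto_zero.2 hx.summable.tendsto_atTop_zero

/-- Multiplication by the indicator function of a measurable set, as an operator on `L²`. -/
noncomputable def truncL (U : Set X) (hU : MeasurableSet U) : Lp ℂ 2 m →L[ℂ] Lp ℂ 2 m :=
  LinearMap.mkContinuous
    { toFun := fun g => ((Lp.memLp g).indicator hU).toLp _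
      map_add' := fun f g => by
        apply Lp.ext
        filter_upwards [((Lp.memLp (f + g)).indicator hU).coeFn_toLp,
          ((Lp.memLp f).indicator hU).coeFn_toLp, ((Lp.memLp g).indicator hU).coeFn_toLp,
          Lp.coeFn_add f g, Lp.coeFn_add (((Lp.memLp f).indicator hU).toLp _)
            (((Lp.memLp g).indicator hU).toLp _)] with x h1 h2 h3 h4 h5
        rw [h1, h5, Pi.add_apply, h2, h3]
        by_cases hx : x ∈ U
        · simp only [indicator_of_mem hx]
          exact h4
        · simp [hx]
      map_smul' := fun c f => by
        apply Lp.ext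
        filter_upwards [((Lp.memLp (c • f)).indicator hU).coeFn_toLp,
          ((Lp.memLp f).indicator hU).coeFn_toLp, Lp.coeFn_smul c f,
          Lp.coeFn_smul c (((Lp.memLp f).indicator hU).toLp _)] with x h1 h2 h3 h4
        rw [h1, RingHom.id_apply, h4, Pi.smul_apply, h2]
        by_cases hx : x ∈ U <;> simp [hx, h3] }
    1 fun g => by
      rw [one_mul]
      refine Lp.norm_le_norm_of_ae_le ?_
      filter_upwards [((Lp.memLp g).indicator hU).coeFn_toLp] with x hx
      rw [LinearMap.coe_mk, AddHom.coe_mk, hx]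
      exact norm_indicator_le_norm_self _ _

theorem truncL_coeFn (U : Set X) (hU : MeasurableSet U) (g : Lp ℂ 2 m) :
    truncL U hU g =ᵐ[m] U.indicator g :=
  ((Lp.memLp g).indicator hU).coeFn_toLp

theorem tendsto_truncL {U : ℕ → Set X} (hU : ∀ n, MeasurableSet (U n)) (hmono : Monotone U)
    (hcov : ∀ᵐ x ∂m, ∃ n, x ∈ U n) (g : Lp ℂ 2 m) :
    Tendsto (fun n => truncL (U n) (hU n) g) atTop (𝓝 g) := by
  rw [Lp.tendsto_Lp_iff_tendsto_eLpNorm']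
  have heq : ∀ n, eLpNorm (⇑(truncL (U n) (hU n) g) - ⇑g) 2 m =
      (∫⁻ x, ‖(U n)ᶜ.indicator g x‖ₑ ^ (2 : ℝ) ∂m) ^ (1 / (2 : ℝ)) := by
    intro n
    rw [eLpNorm_eq_lintegral_rpow_enorm_toReal two_ne_zero ENNReal.ofNat_ne_top]
    simp only [ENNReal.toReal_ofNat]
    congr 1
    refine lintegral_congr_ae ?_
    filter_upwards [truncL_coeFn (U n) (hU n) g] with x hx
    rw [Pi.sub_apply, hx]
    by_cases hxU : x ∈ U n <;> simp [hxU]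
  simp_rw [heq]
  have h0 : Tendsto (fun n => ∫⁻ x, ‖(U n)ᶜ.indicator g x‖ₑ ^ (2 : ℝ) ∂m) atTop
      (𝓝 (∫⁻ _, 0 ∂m)) := by
    refine tendsto_lintegral_of_dominated_convergence' (fun x => ‖g x‖ₑ ^ (2 : ℝ)) ?_ ?_ ?_ ?_
    · exact fun n => (((Lp.memLp g).indicator (hU n).compl).aestronglyMeasurable.enorm).pow_const _
    · refine fun n => Eventually.of_forall fun x => ?_
      dsimp only
      gcongr
      exact enorm_indicator_le_enorm_self _ _
    · have := lintegral_rpow_enorm_lt_top_of_eLpNorm_lt_top two_ne_zero ENNReal.ofNat_ne_top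
        (Lp.memLp g).eLpNorm_lt_top
      simpa using this.ne
    · filter_upwards [hcov] with x ⟨n, hn⟩
      refine tendsto_const_nhds.congr' ?_
      filter_upwards [eventually_ge_atTop n] with j hj
      simp [hmono hj hn]
  rw [lintegral_zero] at h0
  have := (ENNReal.continuous_rpow_const (y := 1 / (2 : ℝ))).tendsto 0 |>.comp h0
  rw [ENNReal.zero_rpow_of_pos (by norm_num)] at this
  exact this

/-- A property of sets that is stable under disjoint unions and holds for the measurable subsets of
each `B n` holds for the measurable subsets of finite unions of these sets. -/
theorem measurableSet_induction_partialSups {B : ℕ → Set X} (hB : ∀ n, MeasurableSet (B n))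
    {P : Set X → Prop} (hP : ∀ n E, MeasurableSet E → E ⊆ B n → P E)
    (hunion : ∀ E F, MeasurableSet E → MeasurableSet F → Disjoint E F → P E → P F → P (E ∪ F))
    (N : ℕ) : ∀ E, MeasurableSet E → E ⊆ partialSups B N → P E := by
  have hU : ∀ N, MeasurableSet (partialSups B N) := fun N => by
    rw [partialSups_eq_biUnion_range]
    exact Finset.measurableSet_biUnion _ fun n _ => hB n
  induction N with
  | zero => intro E hE hsub; exact hP 0 E hE (by simpa using hsub)
  | succ N ih =>
    intro E hE hsub
    rw [← inter_union_sdiff E (partialSups B N)]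
    refine hunion _ _ (hE.inter (hU N)) (hE.diff (hU N)) disjoint_sdiff_inter.symm
      (ih _ (hE.inter (hU N)) inter_subset_right) (hP (N + 1) _ (hE.diff (hU N)) ?_)
    rw [partialSups_add_one] at hsub
    rintro x ⟨hxE, hxU⟩
    exact (hsub hxE).resolve_left hxU

theorem smul_indicatorConstLp_one {s : Set X} (hs : MeasurableSet s) (hfin : m s ≠ ∞) (c : ℂ) :
    indicatorConstLp 2 hs hfin c = c • indicatorConstLp 2 hs hfin (1 : ℂ) := by
  apply Lp.ext
  filter_upwards [indicatorConstLp_coeFn (p := 2) (hs := hs) (hμs := hfin) (c := c),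
    indicatorConstLp_coeFn (p := 2) (hs := hs) (hμs := hfin) (c := (1 : ℂ)),
    Lp.coeFn_smul c (indicatorConstLp 2 hs hfin (1 : ℂ))] with x h1 h2 h3
  rw [h1, h3, Pi.smul_apply, h2]
  by_cases hx : x ∈ s <;> simp [hx]

theorem truncL_indicatorConstLp {U s : Set X} (hU : MeasurableSet U) (hs : MeasurableSet s)
    (hfin : m s ≠ ∞) (hfin' : m (s ∩ U) ≠ ∞) (c : ℂ) :
    truncL U hU (indicatorConstLp 2 hs hfin c) = indicatorConstLp 2 (hs.inter hU) hfin' c := by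
  apply Lp.ext
  filter_upwards [indicatorConstLp_coeFn (p := 2) (hs := hs) (hμs := hfin) (c := c),
    indicatorConstLp_coeFn (p := 2) (hs := hs.inter hU) (hμs := hfin') (c := c),
    truncL_coeFn U hU (indicatorConstLp 2 hs hfin c)] with x h1 h2 h3
  rw [h3, h2]
  by_cases hx : x ∈ U <;> by_cases hxs : x ∈ s <;> simp [hx, hxs, h1]

/-- Bounded operators on `L²` that agree on indicator functions are equal. -/
theorem Lp_ext_of_indicator {T T' : Lp ℂ 2 m →L[ℂ] Lp ℂ 2 m}
    (h : ∀ (E : Set X) (hE : MeasurableSet E) (hfin : m E ≠ ∞),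
      T (indicatorConstLp 2 hE hfin 1) = T' (indicatorConstLp 2 hE hfin 1)) : T = T' := by
  ext1 g
  induction g using Lp.induction (by norm_num : (2 : ℝ≥0∞) ≠ ∞) with
  | indicatorConst c hs hμs =>
    rw [Lp.simpleFunc.coe_indicatorConst, smul_indicatorConstLp_one, map_smul, map_smul,
      h _ hs hμs.ne]
  | add hf hg _ h1 h2 => rw [map_add, map_add, h1, h2]
  | isClosed => exact isClosed_eq T.continuous T'.continuous

/-- Bounded operators on `L²` that agree on the indicator functions of the subsets of the members of
a countable cover are equal. -/
theorem Lp_ext_of_cover {T T' : Lp ℂ 2 m →L[ℂ] Lp ℂ 2 m} {B : ℕ → Set X}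
    (hB : ∀ n, MeasurableSet (B n)) (hcov : ∀ᵐ x ∂m, ∃ n, x ∈ B n)
    (h : ∀ n (E : Set X) (hE : MeasurableSet E) (hfin : m E ≠ ∞), E ⊆ B n →
      T (indicatorConstLp 2 hE hfin 1) = T' (indicatorConstLp 2 hE hfin 1)) : T = T' := by
  refine Lp_ext_of_indicator fun E hE hfin => ?_
  have hU : ∀ N, MeasurableSet (partialSups B N) := fun N => by
    rw [partialSups_eq_biUnion_range]
    exact Finset.measurableSet_biUnion _ fun n _ => hB n
  have hlim := tendsto_truncL (m := m) hU (partialSups B).monotone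
    (by
      filter_upwards [hcov] with x ⟨n, hn⟩
      exact ⟨n, le_partialSups B n hn⟩) (indicatorConstLp 2 hE hfin 1)
  refine tendsto_nhds_unique ((T.continuous.tendsto _).comp hlim)
    (((T'.continuous.tendsto _).comp hlim).congr fun N => ?_)
  have hfin' : m (E ∩ partialSups B N) ≠ ∞ := measure_ne_top_of_subset inter_subset_left hfin
  simp only [Function.comp_apply]
  rw [truncL_indicatorConstLp (hU N) hE hfin hfin']
  refine (measurableSet_induction_partialSups hB
    (P := fun E => ∀ (hE : MeasurableSet E) (hfin : m E ≠ ∞),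
      T (indicatorConstLp 2 hE hfin 1) = T' (indicatorConstLp 2 hE hfin 1))
    (fun n E _ hsub hE hfin => h n E hE hfin hsub) ?_ N _ (hE.inter (hU N)) inter_subset_right
    (hE.inter (hU N)) hfin').symm
  intro E F hE hF hd h1 h2 hEF hfinEF
  have hfE := measure_ne_top_of_subset subset_union_left hfinEF
  have hfF := measure_ne_top_of_subset subset_union_right hfinEF
  rw [indicatorConstLp_disjoint_union hE hF hfE hfF hd, map_add, map_add, h1 hE hfE, h2 hF hfF]

end LpTools

/-! ### Operators on L² given by summation along fibres. -/

section FiberSum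

variable {X : Type*} {σ : X → X} {k : X → X → ℂ}

/-- The sum `∑_b k(x, b) g(b)` over the fibre of `σ` through `x`. -/
noncomputable def fiberSum (σ : X → X) (k : X → X → ℂ) (g : X → ℂ) (x : X) : ℂ :=
  ∑' b : {b // σ b = σ x}, k x b * g b

/-- Convergence of the series defining `fiberSum`. -/
def FiberSummable (σ : X → X) (k : X → X → ℂ) (g : X → ℂ) (x : X) : Prop :=
  Summable fun b : {b // σ b = σ x} => k x b * g b

theorem fiberSum_congr {g g' : X → ℂ} {x : X} (h : ∀ b, σ b = σ x → g b = g' b) :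
    fiberSum σ k g x = fiberSum σ k g' x :=
  tsum_congr fun b => by rw [h b b.2]

theorem fiberSum_add {g g' : X → ℂ} {x : X} (h : FiberSummable σ k g x)
    (h' : FiberSummable σ k g' x) :
    fiberSum σ k (g + g') x = fiberSum σ k g x + fiberSum σ k g' x := by
  unfold fiberSum
  rw [← Summable.tsum_add h h']
  exact tsum_congr fun b => by rw [Pi.add_apply, mul_add]

theorem fiberSum_smul (c : ℂ) (g : X → ℂ) (x : X) :
    fiberSum σ k (c • g) x = c * fiberSum σ k g x := by
  unfold fiberSum
  rw [← tsum_mul_left]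
  exact tsum_congr fun b => by rw [Pi.smul_apply, smul_eq_mul]; ring

theorem fiberSummable_indicator {U : Set X} {x : X} (hU : {b | σ b = σ x ∧ b ∈ U}.Finite)
    (g : X → ℂ) : FiberSummable σ k (U.indicator g) x := by
  refine summable_of_hasFiniteSupport ((hU.preimage Subtype.val_injective.injOn).subset ?_)
  intro b hb
  refine ⟨b.2, ?_⟩
  by_contra h
  exact hb (by simp [h])

theorem finite_fiber_inter_partialSups {B : ℕ → Set X} (hinj : ∀ n, InjOn σ (B n)) (N : ℕ)
    (x : X) : {b | σ b = σ x ∧ b ∈ partialSups B N}.Finite := by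
  have : {b | σ b = σ x ∧ b ∈ partialSups B N} ⊆
      ⋃ n ∈ Finset.range (N + 1), {b | σ b = σ x ∧ b ∈ B n} := by
    rintro b ⟨hb, hbU⟩
    rw [partialSups_eq_biUnion_range] at hbU
    obtain ⟨n, hn, hbn⟩ := mem_iUnion₂.1 hbU
    exact mem_iUnion₂.2 ⟨n, hn, hb, hbn⟩
  refine (Finite.biUnion (Finset.finite_toSet _) fun n _ => ?_).subset this
  exact Subsingleton.finite fun b hb b' hb' => hinj n hb.2 hb'.2 (hb.1.trans hb'.1.symm)

/-- By the Lusin-Souslin theorem an injective Borel map on a Borel set is a measurable embedding;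
its inverse extends from the Borel image to the whole space. -/
theorem exists_measurable_section [MeasurableSpace X] [StandardBorelSpace X] (hσ : Measurable σ)
    {C : Set X} (hC : MeasurableSet C) (hinj : InjOn σ C) :
    ∃ c : X → X, Measurable c ∧ ∀ x ∈ C, c (σ x) = x := by
  have := hC.standardBorel
  have hemb : MeasurableEmbedding fun x : C => σ x :=
    (hσ.comp measurable_subtype_coe).measurableEmbedding
      fun x y hxy => Subtype.ext (hinj x.2 y.2 hxy)
  obtain ⟨c, hc, hc'⟩ := hemb.exists_measurable_extend measurable_subtype_coe fun x => ⟨x⟩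
  exact ⟨c, hc, fun x hx => congrFun hc' ⟨x, hx⟩⟩

variable [MeasurableSpace X] {m : Measure X}

/-- Almost everywhere properties hold on the whole fibre through almost every point. -/
def FiberAE (σ : X → X) (m : Measure X) : Prop :=
  ∀ ⦃P : X → Prop⦄, (∀ᵐ x ∂m, P x) → ∀ᵐ x ∂m, ∀ b, σ b = σ x → P b

theorem FiberAE.fiberSum_ae_eq (hae : FiberAE σ m) {g g' : X → ℂ} (h : g =ᵐ[m] g') :
    fiberSum σ k g =ᵐ[m] fiberSum σ k g' := by
  filter_upwards [hae h] with x hx using fiberSum_congr hx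

/-- An everywhere defined operator on `L²` given by summation along the fibres is bounded. -/
theorem FiberAE.exists_continuousLinearMap (hae : FiberAE σ m)
    (h : ∀ g : Lp ℂ 2 m, (∀ᵐ x ∂m, FiberSummable σ k g x) ∧ MemLp (fiberSum σ k g) 2 m) :
    ∃ T : Lp ℂ 2 m →L[ℂ] Lp ℂ 2 m, ∀ g, T g =ᵐ[m] fiberSum σ k g := by
  let T₀ : Lp ℂ 2 m →ₗ[ℂ] Lp ℂ 2 m :=
    { toFun := fun g => (h g).2.toLp _
      map_add' := fun f g => by
        apply Lp.ext
        filter_upwards [(h (f + g)).2.coeFn_toLp, (h f).2.coeFn_toLp, (h g).2.coeFn_toLp,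
          hae.fiberSum_ae_eq (k := k) (Lp.coeFn_add f g), (h f).1, (h g).1,
          Lp.coeFn_add ((h f).2.toLp _) ((h g).2.toLp _)] with x h1 h2 h3 h4 h5 h6 h7
        rw [h1, h7, Pi.add_apply, h2, h3, h4, fiberSum_add h5 h6]
      map_smul' := fun c f => by
        apply Lp.ext
        filter_upwards [(h (c • f)).2.coeFn_toLp, (h f).2.coeFn_toLp,
          hae.fiberSum_ae_eq (k := k) (Lp.coeFn_smul c f),
          Lp.coeFn_smul c ((h f).2.toLp _)] with x h1 h2 h3 h4
        rw [h1, RingHom.id_apply, h4, Pi.smul_apply, h2, h3, fiberSum_smul, smul_eq_mul] }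
  have hT₀ : ∀ g, T₀ g =ᵐ[m] fiberSum σ k g := fun g => (h g).2.coeFn_toLp
  -- Closed graph theorem. A subsequence of `u` is dominated by `H` and `g`, both in L², and by
  -- hypothesis their series along almost every fibre converge absolutely; dominated convergence
  -- then passes to the limit in each fibre sum.
  refine ⟨ContinuousLinearMap.ofSeqClosedGraph (g := T₀) ?_, hT₀⟩
  intro u g y hu hy
  obtain ⟨φ, hφ, H, hH, hφae⟩ := Lp_exists_subseq_dominated hu
  obtain ⟨ψ, hψ, hψae⟩ := Lp_exists_subseq_tendsto_ae (hy.comp hφ.tendsto_atTop)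
  have hall : ∀ᵐ x ∂m, ∀ n, T₀ (u (φ (ψ n))) x = fiberSum σ k (u (φ (ψ n))) x :=
    ae_all_iff.2 fun n => hT₀ _
  apply Lp.ext
  filter_upwards [hψae, hall, hT₀ g, hae hH, hae hφae, (h H).1, (h g).1]
    with x h1 h2 h3 h4 h5 h6 h7
  rw [h3]
  refine tendsto_nhds_unique h1 ?_
  simp only [Function.comp_apply, h2]
  refine tendsto_tsum_of_dominated_convergence
    (bound := fun b : {b // σ b = σ x} => ‖k x b * H b‖ + ‖k x b * g b‖) (h6.norm.add h7.norm)
    (fun b => ((h5 b b.2).comp hψ.tendsto_atTop).const_mul _) (Eventually.of_forall fun n b => ?_)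
  rw [norm_mul, norm_mul, norm_mul, ← mul_add]
  gcongr
  calc ‖u (φ (ψ n)) b‖ = ‖(u (φ (ψ n)) b - g b) + g b‖ := by rw [sub_add_cancel]
    _ ≤ ‖u (φ (ψ n)) b - g b‖ + ‖g b‖ := norm_add_le _ _
    _ ≤ _ := by gcongr; exact h4 b b.2 (ψ n)

/-- An operator that acts by summation along the fibres on the indicator functions of subsets of a
set `U` with finite fibres does so on all functions supported in `U`. -/
theorem FiberAE.apply_truncL (hae : FiberAE σ m) {T : Lp ℂ 2 m →L[ℂ] Lp ℂ 2 m} {U : Set X}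
    (hU : MeasurableSet U) (hfinite : ∀ x, {b | σ b = σ x ∧ b ∈ U}.Finite)
    (hT : ∀ (E : Set X) (hE : MeasurableSet E) (hfin : m E ≠ ∞), E ⊆ U →
      T (indicatorConstLp 2 hE hfin 1) =ᵐ[m] fiberSum σ k (E.indicator 1)) (g : Lp ℂ 2 m) :
    T (truncL U hU g) =ᵐ[m] fiberSum σ k (U.indicator g) := by
  induction g using Lp.induction (by norm_num : (2 : ℝ≥0∞) ≠ ∞) with
  | indicatorConst c hs hμs =>
    rename_i s
    have hfin : m (s ∩ U) ≠ ∞ := measure_ne_top_of_subset inter_subset_left hμs.ne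
    rw [Lp.simpleFunc.coe_indicatorConst, truncL_indicatorConstLp hU hs hμs.ne hfin,
      smul_indicatorConstLp_one, map_smul]
    filter_upwards [hT _ (hs.inter hU) hfin inter_subset_right,
      Lp.coeFn_smul c (T (indicatorConstLp 2 (hs.inter hU) hfin 1)),
      hae (indicatorConstLp_coeFn (p := 2) (hs := hs) (hμs := hμs.ne) (c := c))] with x h1 h2 h3
    rw [h2, Pi.smul_apply, h1, smul_eq_mul, ← fiberSum_smul]
    refine fiberSum_congr fun b hb => ?_
    by_cases hbU : b ∈ U <;> by_cases hbs : b ∈ s <;> simp [hbU, hbs, h3 b hb]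
  | add hf hg _ h1 h2 =>
    rw [map_add, map_add]
    filter_upwards [h1, h2, Lp.coeFn_add (T (truncL U hU (hf.toLp _))) (T (truncL U hU (hg.toLp _))),
      hae (Lp.coeFn_add (hf.toLp _) (hg.toLp _))] with x h1 h2 h3 h4
    rw [h3, Pi.add_apply, h1, h2, ← fiberSum_add (fiberSummable_indicator (hfinite x) _)
      (fiberSummable_indicator (hfinite x) _), ← indicator_add']
    refine fiberSum_congr fun b hb => ?_
    by_cases hbU : b ∈ U
    · simp only [indicator_of_mem hbU]; rw [h4 b hb]
    · simp only [indicator_of_notMem hbU]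
  | isClosed =>
    refine IsSeqClosed.isClosed fun u g hmem hlim => ?_
    obtain ⟨φ, hφ, hφae⟩ := Lp_exists_subseq_tendsto_ae hlim
    have hT' : Tendsto (fun n => T (truncL U hU (u (φ n)))) atTop (𝓝 (T (truncL U hU g))) :=
      (((T.continuous.comp (truncL U hU).continuous).tendsto g).comp hlim).comp hφ.tendsto_atTop
    obtain ⟨ψ, hψ, hψae⟩ := Lp_exists_subseq_tendsto_ae hT'
    have hall : ∀ᵐ x ∂m, ∀ n, T (truncL U hU (u (φ (ψ n)))) x =
        fiberSum σ k (U.indicator (u (φ (ψ n)))) x := ae_all_iff.2 fun n => hmem _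
    filter_upwards [hψae, hall, hae hφae] with x h1 h2 h3
    simp only [h2] at h1
    refine tendsto_nhds_unique h1 ?_
    have hfin := (hfinite x).preimage (f := ((↑) : {b // σ b = σ x} → X)) Subtype.val_injective.injOn
    have hsum : ∀ h : X → ℂ, fiberSum σ k (U.indicator h) x =
        ∑ b ∈ hfin.toFinset, k x b * U.indicator h b := fun h =>
      tsum_eq_sum fun b hb => by
        have : (b : X) ∉ U := fun hbU => hb (hfin.mem_toFinset.2 ⟨b.2, hbU⟩)
        simp [this]
    simp only [hsum]
    refine tendsto_finsetSum _ fun b _ => Tendsto.const_mul _ ?_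
    by_cases hbU : (b : X) ∈ U
    · simp only [indicator_of_mem hbU]
      exact (h3 b b.2).comp hψ.tendsto_atTop
    · simp [hbU]

/-- A bounded operator on `L²` that acts by summation along the fibres of `σ` on enough indicator
functions does so everywhere, with absolute convergence almost everywhere. -/
theorem FiberAE.apply_eq_fiberSum [StandardBorelSpace X] (hae : FiberAE σ m) (hσ : Measurable σ)
    (hk : Measurable (Function.uncurry k)) {T : Lp ℂ 2 m →L[ℂ] Lp ℂ 2 m} {B : ℕ → Set X}
    (hB : ∀ n, MeasurableSet (B n)) (hinj : ∀ n, InjOn σ (B n))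
    (hcov : ∀ᵐ x ∂m, ∃ n, x ∈ B n)
    (hT : ∀ n (E : Set X) (hE : MeasurableSet E) (hfin : m E ≠ ∞), E ⊆ B n →
      T (indicatorConstLp 2 hE hfin 1) =ᵐ[m] fiberSum σ k (E.indicator 1)) (g : Lp ℂ 2 m) :
    (∀ᵐ x ∂m, FiberSummable σ k g x) ∧ T g =ᵐ[m] fiberSum σ k g := by
  let U : ℕ → Set X := fun N => partialSups B N
  have hU : ∀ N, MeasurableSet (U N) := fun N => by
    simp only [U, partialSups_eq_biUnion_range]
    exact Finset.measurableSet_biUnion _ fun n _ => hB n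
  have hUmono : Monotone U := (partialSups B).monotone
  have hUcov : ∀ᵐ x ∂m, ∃ n, x ∈ U n := by
    filter_upwards [hcov] with x ⟨n, hn⟩
    exact ⟨n, le_partialSups B n hn⟩
  have hUfin : ∀ N x, {b | σ b = σ x ∧ b ∈ U N}.Finite := finite_fiber_inter_partialSups hinj
  have hTU : ∀ N (g : Lp ℂ 2 m),
      T (truncL (U N) (hU N) g) =ᵐ[m] fiberSum σ k ((U N).indicator g) := by
    intro N
    refine hae.apply_truncL (hU N) (hUfin N) fun E hE hfin hsub => ?_
    refine measurableSet_induction_partialSups hB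
      (P := fun E => ∀ (hE : MeasurableSet E) (hfin : m E ≠ ∞), E ⊆ U N →
        T (indicatorConstLp 2 hE hfin 1) =ᵐ[m] fiberSum σ k (E.indicator 1))
      (fun n E _ hsub hE hfin _ => hT n E hE hfin hsub) ?_ N E hE hsub hE hfin hsub
    intro E F hE hF hd h1 h2 hEF hfinEF hsub
    have hfE := measure_ne_top_of_subset subset_union_left hfinEF
    have hfF := measure_ne_top_of_subset subset_union_right hfinEF
    have hsE := subset_union_left.trans hsub
    have hsF := subset_union_right.trans hsub
    rw [indicatorConstLp_disjoint_union hE hF hfE hfF hd, map_add]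
    filter_upwards [h1 hE hfE hsE, h2 hF hfF hsF, Lp.coeFn_add (T (indicatorConstLp 2 hE hfE 1))
      (T (indicatorConstLp 2 hF hfF 1))] with x h1 h2 h3
    rw [h3, Pi.add_apply, h1, h2, indicator_union_of_disjoint hd]
    exact (fiberSum_add
      (fiberSummable_indicator ((hUfin N x).subset fun b hb => ⟨hb.1, hsE hb.2⟩) _)
      (fiberSummable_indicator ((hUfin N x).subset fun b hb => ⟨hb.1, hsF hb.2⟩) _)).symm
  have hsummable : ∀ᵐ x ∂m, FiberSummable σ k g x := by
    suffices h : ∀ n, ∀ᵐ x ∂m, x ∈ B n → FiberSummable σ k g x by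
      filter_upwards [hcov, ae_all_iff.2 h] with x ⟨n, hn⟩ hx using hx n hn
    intro n
    -- Twist `g` by a phase so that all terms of the series become nonnegative on `B n`.
    obtain ⟨c, hc, hcB⟩ := exists_measurable_section hσ (hB n) (hinj n)
    -- A phase making the terms at `x` nonnegative depends on `x`. Since each fibre meets `B n` in
    -- at most one point, `c (σ b)` recovers `x` from `b` when `x ∈ B n`, and one function `u`
    -- serves all these `x` together.
    let z : X → ℂ := fun b => k (c (σ b)) b * g b
    let u : X → ℂ := fun b => starRingEnd ℂ (z b) / (‖z b‖ : ℂ)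
    have hz : Measurable z :=
      (hk.comp ((hc.comp hσ).prodMk measurable_id)).mul (Lp.stronglyMeasurable g).measurable
    have hu : Measurable u :=
      (RCLike.continuous_conj.measurable.comp hz).div (Complex.measurable_ofReal.comp hz.norm)
    have hu1 : ∀ b, ‖u b‖ ≤ 1 := fun b => by
      simp only [u, norm_div, RCLike.norm_conj, Complex.norm_real, norm_norm]
      exact div_self_le_one _
    have huz : ∀ b, u b * z b = (‖z b‖ : ℂ) := fun b => by
      simp only [u]
      rcases eq_or_ne (z b) 0 with h0 | h0
      · simp [h0]
      · have : (‖z b‖ : ℂ) ≠ 0 := by simpa using h0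
        rw [div_mul_eq_mul_div, div_eq_iff this, mul_comm, Complex.mul_conj']
        ring
    have hmem : MemLp (fun b => u b * g b) 2 m :=
      (Lp.memLp g).of_le (hu.aestronglyMeasurable.mul (Lp.aestronglyMeasurable g))
        (Eventually.of_forall fun b => by
          rw [norm_mul]
          exact mul_le_of_le_one_left (norm_nonneg _) (hu1 b))
    let g' : Lp ℂ 2 m := hmem.toLp _
    obtain ⟨φ, hφ, hφae⟩ := Lp_exists_subseq_tendsto_ae
      ((T.continuous.tendsto g').comp (tendsto_truncL hU hUmono hUcov g'))
    have hall : ∀ᵐ x ∂m, ∀ N, T (truncL (U (φ N)) (hU (φ N)) g') x =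
        fiberSum σ k ((U (φ N)).indicator g') x := ae_all_iff.2 fun N => hTU _ _
    filter_upwards [hφae, hall, hae hmem.coeFn_toLp, hae hUcov] with x h1 h2 h3 h4 hxB
    simp only [Function.comp_apply, h2] at h1
    -- Every finite sum of absolute values is eventually at most the value of `T` at a truncation of
    -- `g'`, which is a sum of nonnegative terms and converges to `T g' x` along the subsequence.
    refine Summable.of_norm (summable_of_sum_le (c := (T g' x).re) (fun _ => norm_nonneg _) ?_)
    intro s
    have hev : ∀ᶠ N in atTop, ∀ b ∈ s, (b : X) ∈ U (φ N) := by
      refine (Finset.eventually_all s).2 fun b _ => ?_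
      obtain ⟨N, hN⟩ := h4 b b.2
      filter_upwards [eventually_ge_atTop N] with j hj
      exact hUmono (hj.trans hφ.le_apply) hN
    refine ge_of_tendsto ((Complex.continuous_re.tendsto _).comp h1) ?_
    filter_upwards [hev] with N hN
    have hterm : ∀ b : {b // σ b = σ x}, k x b * (U (φ N)).indicator g' b =
        (((U (φ N)).indicator (fun b => ‖k x b * g b‖) b : ℝ) : ℂ) := by
      intro b
      by_cases hb : (b : X) ∈ U (φ N)
      · have hcb : c (σ b) = x := by rw [b.2, hcB x hxB]
        have hzb : z b = k x b * g b := by simp only [z, hcb]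
        rw [indicator_of_mem hb, indicator_of_mem hb, h3 b b.2, ← hzb, ← huz b, hzb]
        ring
      · simp [hb]
    have hsumm : Summable fun b : {b // σ b = σ x} =>
        ((U (φ N)).indicator (fun b => ‖k x b * g b‖) b : ℝ) := by
      have := fiberSummable_indicator (k := k) (hUfin (φ N) x) g'
      unfold FiberSummable at this
      simp only [hterm] at this
      exact_mod_cast this
    have hval : (fiberSum σ k ((U (φ N)).indicator g') x).re =
        ∑' b : {b // σ b = σ x}, ((U (φ N)).indicator (fun b => ‖k x b * g b‖) b : ℝ) := by
      unfold fiberSum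
      simp only [hterm]
      rw [← Complex.ofReal_tsum, Complex.ofReal_re]
    rw [Function.comp_apply, hval]
    refine le_trans (le_of_eq (Finset.sum_congr rfl fun b hb => ?_))
      (hsumm.sum_le_tsum s fun b _ => indicator_nonneg (fun _ _ => norm_nonneg _) _)
    rw [indicator_of_mem (hN b hb)]
  refine ⟨hsummable, ?_⟩
  obtain ⟨φ, hφ, hφae⟩ := Lp_exists_subseq_tendsto_ae
    ((T.continuous.tendsto g).comp (tendsto_truncL hU hUmono hUcov g))
  have hall : ∀ᵐ x ∂m, ∀ N, T (truncL (U (φ N)) (hU (φ N)) g) x =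
      fiberSum σ k ((U (φ N)).indicator g) x := ae_all_iff.2 fun N => hTU _ _
  filter_upwards [hφae, hall, hsummable, hae hUcov] with x h1 h2 h3 h4
  simp only [Function.comp_apply, h2] at h1
  refine tendsto_nhds_unique h1 ?_
  refine tendsto_tsum_of_dominated_convergence (bound := fun b : {b // σ b = σ x} => ‖k x b * g b‖)
    h3.norm (fun b => ?_) (Eventually.of_forall fun N b => ?_)
  · refine tendsto_const_nhds.congr' ?_
    obtain ⟨N, hN⟩ := h4 b b.2
    filter_upwards [eventually_ge_atTop N] with j hj
    rw [indicator_of_mem (hUmono (hj.trans hφ.le_apply) hN)]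
  · rw [norm_mul, norm_mul]
    gcongr
    exact norm_indicator_le_norm_self _ _

end FiberSum

/-! ### Groupoid calculus and twisted convolution. -/

namespace DiscreteBorelGroupoid

variable {G : Type*} [MeasurableSpace G] {𝒢 : DiscreteBorelGroupoid G}

theorem mul_inv_mul_cancel {x b : G} (h : 𝒢.src b = 𝒢.src x) :
    𝒢.mul (𝒢.mul x (𝒢.inv b)) b = x := by
  rw [𝒢.mul_assoc _ _ _ (by rw [𝒢.tgt_inv, h]) (𝒢.src_inv b), 𝒢.inv_mul, h, 𝒢.mul_src_self]

theorem mul_mul_inv_cancel {a b : G} (h : 𝒢.src a = 𝒢.tgt b) :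
    𝒢.mul (𝒢.mul a b) (𝒢.inv b) = a := by
  rw [𝒢.mul_assoc _ _ _ h (𝒢.tgt_inv b).symm, 𝒢.mul_inv, ← h, 𝒢.mul_src_self]

theorem inv_mul_mul_cancel {a b : G} (h : 𝒢.src a = 𝒢.tgt b) :
    𝒢.mul (𝒢.inv a) (𝒢.mul a b) = b := by
  rw [← 𝒢.mul_assoc _ _ _ (𝒢.src_inv a) h, 𝒢.inv_mul, h, 𝒢.tgt_mul_self]

theorem mul_mul_inv_mul_cancel {x a : G} (h : 𝒢.tgt a = 𝒢.tgt x) :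
    𝒢.mul a (𝒢.mul (𝒢.inv a) x) = x := by
  rw [← 𝒢.mul_assoc _ _ _ (𝒢.tgt_inv a).symm (by rw [𝒢.src_inv, h]), 𝒢.mul_inv, h, 𝒢.tgt_mul_self]

theorem inv_inv (g : G) : 𝒢.inv (𝒢.inv g) = g := by
  have h := inv_mul_mul_cancel (𝒢 := 𝒢) (a := 𝒢.inv g) (b := g) (𝒢.src_inv g)
  rw [𝒢.inv_mul] at h
  have h' := 𝒢.mul_src_self (𝒢.inv (𝒢.inv g))
  rw [𝒢.src_inv, 𝒢.tgt_inv] at h'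
  rw [← h', h]

theorem src_mul_inv {x b : G} (h : 𝒢.src b = 𝒢.src x) :
    𝒢.src (𝒢.mul x (𝒢.inv b)) = 𝒢.tgt b := by
  rw [𝒢.src_mul _ _ (by rw [𝒢.tgt_inv, h]), 𝒢.src_inv]

theorem tgt_inv_mul {x a : G} (h : 𝒢.tgt a = 𝒢.tgt x) :
    𝒢.tgt (𝒢.mul (𝒢.inv a) x) = 𝒢.src a := by
  rw [𝒢.tgt_mul _ _ (by rw [𝒢.src_inv, h]), 𝒢.tgt_inv]

theorem src_inv_mul {x a : G} (h : 𝒢.tgt a = 𝒢.tgt x) :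
    𝒢.src (𝒢.mul (𝒢.inv a) x) = 𝒢.src x :=
  𝒢.src_mul _ _ (by rw [𝒢.src_inv, h])

theorem setInv_eq_preimage (A : Set G) : 𝒢.setInv A = 𝒢.inv ⁻¹' A := by
  ext g
  constructor
  · rintro ⟨a, ha, rfl⟩
    rwa [mem_preimage, inv_inv]
  · intro hg
    exact ⟨𝒢.inv g, hg, inv_inv g⟩

theorem setInv_setInv (A : Set G) : 𝒢.setInv (𝒢.setInv A) = A := by
  rw [setInv_eq_preimage, setInv_eq_preimage]
  ext g
  rw [mem_preimage, mem_preimage, inv_inv]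

theorem IsBorelBisection.setInv {A : Set G} (hA : 𝒢.IsBorelBisection A) :
    𝒢.IsBorelBisection (𝒢.setInv A) := by
  rw [setInv_eq_preimage]
  refine ⟨𝒢.measurable_inv hA.measurableSet, fun a ha b hb h => ?_, fun a ha b hb h => ?_⟩
  · rw [← inv_inv (𝒢 := 𝒢) a, ← inv_inv (𝒢 := 𝒢) b]
    exact congrArg 𝒢.inv (hA.injOn_tgt ha hb (by rw [𝒢.tgt_inv, 𝒢.tgt_inv, h]))
  · rw [← inv_inv (𝒢 := 𝒢) a, ← inv_inv (𝒢 := 𝒢) b]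
    exact congrArg 𝒢.inv (hA.injOn_src ha hb (by rw [𝒢.src_inv, 𝒢.src_inv, h]))

theorem Cocycle.conj_conj (ω : 𝒢.Cocycle) : ω.conj.conj = ω := by
  cases ω
  simp [Cocycle.conj]

/-! ### Convolution as summation along the fibres -/

variable (𝒢) in
/-- Factorizations `x = a b` correspond to arrows `b` with the source of `x`. -/
def factorizationsEquivSrc (x : G) : 𝒢.factorizations x ≃ {b // 𝒢.src b = 𝒢.src x} where
  toFun p := ⟨p.1.2, (𝒢.src_mul _ _ p.2.1).symm.trans (congrArg 𝒢.src p.2.2)⟩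
  invFun b := ⟨(𝒢.mul x (𝒢.inv b), b), src_mul_inv b.2, mul_inv_mul_cancel b.2⟩
  left_inv p := by
    obtain ⟨⟨a, b⟩, h, rfl⟩ := p
    exact Subtype.ext (Prod.ext (mul_mul_inv_cancel h) rfl)
  right_inv b := rfl

variable (𝒢) in
/-- Factorizations `x = a b` correspond to arrows `a` with the target of `x`. -/
def factorizationsEquivTgt (x : G) : 𝒢.factorizations x ≃ {a // 𝒢.tgt a = 𝒢.tgt x} where
  toFun p := ⟨p.1.1, (𝒢.tgt_mul _ _ p.2.1).symm.trans (congrArg 𝒢.tgt p.2.2)⟩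
  invFun a := ⟨(a, 𝒢.mul (𝒢.inv a) x), (tgt_inv_mul a.2).symm, mul_mul_inv_mul_cancel a.2⟩
  left_inv p := by
    obtain ⟨⟨a, b⟩, h, rfl⟩ := p
    exact Subtype.ext (Prod.ext rfl (inv_mul_mul_cancel h))
  right_inv a := rfl

open Classical in
variable (𝒢) in
/-- The product, extended to all pairs of arrows. -/
noncomputable def mulExt (p : G × G) : G := if 𝒢.src p.1 = 𝒢.tgt p.2 then 𝒢.mul p.1 p.2 else p.1

open Classical in
/-- The cocycle as a complex function, extended by zero to all pairs of arrows. -/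
noncomputable def Cocycle.ext (ω : 𝒢.Cocycle) (p : G × G) : ℂ :=
  if 𝒢.src p.1 = 𝒢.tgt p.2 then (ω.toFun p.1 p.2 : ℂ) else 0

theorem mulExt_apply {a b : G} (h : 𝒢.src a = 𝒢.tgt b) : 𝒢.mulExt (a, b) = 𝒢.mul a b := if_pos h

theorem Cocycle.ext_apply (ω : 𝒢.Cocycle) {a b : G} (h : 𝒢.src a = 𝒢.tgt b) :
    ω.ext (a, b) = ω.toFun a b := if_pos h

theorem Cocycle.norm_ext_le (ω : 𝒢.Cocycle) (p : G × G) : ‖ω.ext p‖ ≤ 1 := by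
  unfold Cocycle.ext
  split_ifs
  · exact (Circle.norm_coe _).le
  · simp

/-- The kernel of the operator `g ↦ f *_ω g`. -/
noncomputable def leftKernel (ω : 𝒢.Cocycle) (f : G → ℂ) (x b : G) : ℂ :=
  ω.ext (𝒢.mulExt (x, 𝒢.inv b), b) * f (𝒢.mulExt (x, 𝒢.inv b))

/-- The kernel of the operator `g ↦ g *_ω f`. -/
noncomputable def rightKernel (ω : 𝒢.Cocycle) (f : G → ℂ) (x a : G) : ℂ :=
  ω.ext (a, 𝒢.mulExt (𝒢.inv a, x)) * f (𝒢.mulExt (𝒢.inv a, x))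

theorem leftKernel_apply (ω : 𝒢.Cocycle) (f : G → ℂ) {x b : G} (h : 𝒢.src b = 𝒢.src x) :
    leftKernel ω f x b = ω.toFun (𝒢.mul x (𝒢.inv b)) b * f (𝒢.mul x (𝒢.inv b)) := by
  rw [leftKernel, mulExt_apply (by rw [𝒢.tgt_inv, h]), ω.ext_apply (src_mul_inv h)]

theorem rightKernel_apply (ω : 𝒢.Cocycle) (f : G → ℂ) {x a : G} (h : 𝒢.tgt a = 𝒢.tgt x) :
    rightKernel ω f x a = ω.toFun a (𝒢.mul (𝒢.inv a) x) * f (𝒢.mul (𝒢.inv a) x) := by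
  rw [rightKernel, mulExt_apply (by rw [𝒢.src_inv, h]), ω.ext_apply (tgt_inv_mul h).symm]

theorem conv_eq_fiberSum_src (ω : 𝒢.Cocycle) (f g : G → ℂ) (x : G) :
    conv ω f g x = fiberSum 𝒢.src (leftKernel ω f) g x := by
  unfold conv fiberSum
  rw [← (𝒢.factorizationsEquivSrc x).symm.tsum_eq]
  exact tsum_congr fun b => by rw [leftKernel_apply ω f b.2]; rfl

theorem conv_eq_fiberSum_tgt (ω : 𝒢.Cocycle) (f g : G → ℂ) (x : G) :
    conv ω g f x = fiberSum 𝒢.tgt (rightKernel ω f) g x := by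
  unfold conv fiberSum
  rw [← (𝒢.factorizationsEquivTgt x).symm.tsum_eq]
  exact tsum_congr fun b => by rw [rightKernel_apply ω f b.2, mul_right_comm]; rfl

theorem summable_conv_iff_src (ω : 𝒢.Cocycle) (f g : G → ℂ) (x : G) :
    (Summable fun p : 𝒢.factorizations x => (ω.toFun p.1.1 p.1.2 : ℂ) * f p.1.1 * g p.1.2) ↔
      FiberSummable 𝒢.src (leftKernel ω f) g x := by
  rw [← (𝒢.factorizationsEquivSrc x).symm.summable_iff]
  exact summable_congr fun b => by rw [leftKernel_apply ω f b.2]; rfl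

theorem summable_conv_iff_tgt (ω : 𝒢.Cocycle) (f g : G → ℂ) (x : G) :
    (Summable fun p : 𝒢.factorizations x => (ω.toFun p.1.1 p.1.2 : ℂ) * g p.1.1 * f p.1.2) ↔
      FiberSummable 𝒢.tgt (rightKernel ω f) g x := by
  rw [← (𝒢.factorizationsEquivTgt x).symm.summable_iff]
  exact summable_congr fun b => by rw [rightKernel_apply ω f b.2, mul_right_comm]; rfl

/-- The target of a product is that of its first factor, which is therefore determined if it lies in
`A`. Cancellation then determines the second factor, so the series has a single possibly nonzero
term. -/
theorem conv_indicator_left (ω : 𝒢.Cocycle) {A : Set G} (hA : InjOn 𝒢.tgt A) (g : G → ℂ)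
    {a e : G} (ha : a ∈ A) (hae : 𝒢.src a = 𝒢.tgt e) :
    conv ω (A.indicator 1) g (𝒢.mul a e) = ω.toFun a e * g e := by
  unfold conv
  rw [tsum_eq_single (⟨(a, e), hae, rfl⟩ : 𝒢.factorizations (𝒢.mul a e))]
  · simp [ha]
  · rintro ⟨⟨a', e'⟩, h1, h2⟩ hne
    simp only at h1 h2
    by_contra hnz
    have ha' : a' ∈ A := by by_contra h'; simp [h'] at hnz
    have : a' = a := hA ha' ha (by rw [← 𝒢.tgt_mul _ _ h1, h2, 𝒢.tgt_mul _ _ hae])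
    subst this
    have : e' = e := by rw [← inv_mul_mul_cancel h1, h2, inv_mul_mul_cancel hae]
    subst this
    exact hne rfl

theorem conv_indicator_right (ω : 𝒢.Cocycle) {E : Set G} (hE : InjOn 𝒢.src E) (f : G → ℂ)
    {a e : G} (he : e ∈ E) (hae : 𝒢.src a = 𝒢.tgt e) :
    conv ω f (E.indicator 1) (𝒢.mul a e) = ω.toFun a e * f a := by
  unfold conv
  rw [tsum_eq_single (⟨(a, e), hae, rfl⟩ : 𝒢.factorizations (𝒢.mul a e))]
  · simp [he]
  · rintro ⟨⟨a', e'⟩, h1, h2⟩ hne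
    simp only at h1 h2
    by_contra hnz
    have he' : e' ∈ E := by by_contra h'; simp [h'] at hnz
    have : e' = e := hE he' he (by rw [← 𝒢.src_mul _ _ h1, h2, 𝒢.src_mul _ _ hae])
    subst this
    have : a' = a := by rw [← mul_mul_inv_cancel h1, h2, mul_mul_inv_cancel hae]
    subst this
    exact hne rfl

/-- `1_A * 1_E`, if products `a e` with `a ∈ A`, `e ∈ E` have unique factors. -/
theorem conv_indicator_indicator (ω : 𝒢.Cocycle) {A E : Set G}
    (h : InjOn 𝒢.tgt A ∨ InjOn 𝒢.src E) {a e : G} (ha : a ∈ A) (he : e ∈ E)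
    (hae : 𝒢.src a = 𝒢.tgt e) :
    conv ω (A.indicator 1) (E.indicator 1) (𝒢.mul a e) = ω.toFun a e := by
  rcases h with h | h
  · rw [conv_indicator_left ω h _ ha hae, indicator_of_mem he, Pi.one_apply, mul_one]
  · rw [conv_indicator_right ω h _ he hae, indicator_of_mem ha, Pi.one_apply, mul_one]

theorem conv_indicator_indicator_of_notMem (ω : 𝒢.Cocycle) {A E : Set G} {x : G}
    (h : x ∉ 𝒢.setMul A E) : conv ω (A.indicator 1) (E.indicator 1) x = 0 := by
  unfold conv
  rw [← tsum_zero]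
  refine tsum_congr ?_
  rintro ⟨⟨a, e⟩, h1, h2⟩
  by_cases ha : a ∈ A
  · by_cases he : e ∈ E
    · exact absurd ⟨a, ha, e, he, h1, h2⟩ h
    · simp [he]
  · simp [ha]

/-- This is the bridge from the pointwise description of the translation operators to convolutions
of indicator functions. -/
theorem eq_conv_indicator_iff (ω : 𝒢.Cocycle) {A E : Set G}
    (h : InjOn 𝒢.tgt A ∨ InjOn 𝒢.src E) {x : G} {z : ℂ} :
    ((∀ a ∈ A, ∀ e ∈ E, 𝒢.src a = 𝒢.tgt e → 𝒢.mul a e = x → z = ω.toFun a e) ∧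
      (x ∉ 𝒢.setMul A E → z = 0)) ↔ z = conv ω (A.indicator 1) (E.indicator 1) x := by
  constructor
  · rintro ⟨h1, h2⟩
    by_cases hx : x ∈ 𝒢.setMul A E
    · obtain ⟨a, ha, e, he, hae, rfl⟩ := hx
      rw [conv_indicator_indicator ω h ha he hae, h1 a ha e he hae rfl]
    · rw [conv_indicator_indicator_of_notMem ω hx, h2 hx]
  · rintro rfl
    refine ⟨?_, fun hx => conv_indicator_indicator_of_notMem ω hx⟩
    rintro a ha e he hae rfl
    exact conv_indicator_indicator ω h ha he hae

theorem isLeftTranslation_iff {μ : Measure G} {ω : 𝒢.Cocycle} {A : Set G}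
    (hA : 𝒢.IsBorelBisection A) {T : 𝒢.L2 μ →L[ℂ] 𝒢.L2 μ} :
    IsLeftTranslation μ ω A T ↔ ∀ (E : Set G) (hE : MeasurableSet E) (hfin : 𝒢.muS μ E ≠ ∞),
      T (indicatorConstLp 2 hE hfin 1) =ᵐ[𝒢.muS μ] conv ω (A.indicator 1) (E.indicator 1) :=
  forall₃_congr fun _ _ _ =>
    eventually_congr (Eventually.of_forall fun _ => eq_conv_indicator_iff ω (Or.inl hA.injOn_tgt))

/-- The conjugate in the definition of the right translation cancels that in `ω.conj`, which leaves
right convolution with respect to ω. -/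
theorem isRightTranslation_conj_iff {μ : Measure G} {ω : 𝒢.Cocycle} {A : Set G}
    (hA : 𝒢.IsBorelBisection A) {T : 𝒢.L2 μ →L[ℂ] 𝒢.L2 μ} :
    IsRightTranslation μ ω.conj A T ↔
      ∀ (E : Set G) (hE : MeasurableSet E) (hfin : 𝒢.muS μ E ≠ ∞),
        T (indicatorConstLp 2 hE hfin 1) =ᵐ[𝒢.muS μ]
          conv ω (E.indicator 1) ((𝒢.setInv A).indicator 1) := by
  refine forall₃_congr fun E _ _ => eventually_congr (Eventually.of_forall fun x => ?_)
  rw [← eq_conv_indicator_iff ω (Or.inr hA.setInv.injOn_src)]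
  refine and_congr_left fun _ => ?_
  have hstar : ∀ e b, star (ω.conj.toFun e b : ℂ) = ω.toFun e b := fun e b => by
    change starRingEnd ℂ ((ω.toFun e b)⁻¹ : Circle) = _
    rw [Circle.coe_inv_eq_conj, Complex.conj_conj]
  simp only [hstar]
  exact ⟨fun h a ha e he => h e he a ha, fun h a ha e he => h e he a ha⟩

/-! ### Measurability -/

variable [StandardBorelSpace G]

theorem measurable_mulExt : Measurable 𝒢.mulExt := by
  classical
  exact Measurable.dite (s := {p : G × G | 𝒢.src p.1 = 𝒢.tgt p.2}) 𝒢.measurable_mul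
    (measurable_fst.comp measurable_subtype_coe)
    (measurableSet_eq_fun (𝒢.measurable_src.comp measurable_fst)
      (𝒢.measurable_tgt.comp measurable_snd))

theorem Cocycle.measurable_ext (ω : 𝒢.Cocycle) : Measurable ω.ext := by
  classical
  exact Measurable.dite (s := {p : G × G | 𝒢.src p.1 = 𝒢.tgt p.2}) ω.measurable_toFun
    measurable_const
    (measurableSet_eq_fun (𝒢.measurable_src.comp measurable_fst)
      (𝒢.measurable_tgt.comp measurable_snd))

theorem measurable_leftKernel (ω : 𝒢.Cocycle) {f : G → ℂ} (hf : Measurable f) :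
    Measurable (Function.uncurry (leftKernel ω f)) := by
  have h : Measurable fun p : G × G => 𝒢.mulExt (p.1, 𝒢.inv p.2) :=
    measurable_mulExt.comp (measurable_fst.prodMk (𝒢.measurable_inv.comp measurable_snd))
  exact (ω.measurable_ext.comp (h.prodMk measurable_snd)).mul (hf.comp h)

theorem measurable_rightKernel (ω : 𝒢.Cocycle) {f : G → ℂ} (hf : Measurable f) :
    Measurable (Function.uncurry (rightKernel ω f)) := by
  have h : Measurable fun p : G × G => 𝒢.mulExt (𝒢.inv p.2, p.1) :=
    measurable_mulExt.comp ((𝒢.measurable_inv.comp measurable_snd).prodMk measurable_fst)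
  exact (ω.measurable_ext.comp (measurable_snd.prodMk h)).mul (hf.comp h)

end DiscreteBorelGroupoid

/-! ### Square integrability of convolutions with indicators of bisections. -/

section FiberSumIndicator

variable {X : Type*} {σ : X → X} {k : X → X → ℂ}

theorem fiberSum_indicator_one {A : Set X} (hinj : InjOn σ A) {c : X → X}
    (hc : ∀ x ∈ A, c (σ x) = x) :
    fiberSum σ k (A.indicator 1) = (σ ⁻¹' (σ '' A)).indicator fun x => k x (c (σ x)) := by
  ext x
  by_cases hx : x ∈ σ ⁻¹' (σ '' A)
  · rw [indicator_of_mem hx]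
    obtain ⟨a, ha, hax⟩ := hx
    have hcx : c (σ x) = a := by rw [← hax, hc a ha]
    unfold fiberSum
    rw [tsum_eq_single ⟨a, hax⟩, hcx]
    · simp [ha]
    · rintro ⟨b, hb⟩ hne
      have : b ∉ A := fun hbA => hne (Subtype.ext (hinj hbA ha (hb.trans hax.symm)))
      simp [this]
  · rw [indicator_of_notMem hx]
    unfold fiberSum
    rw [← tsum_zero]
    refine tsum_congr fun b => ?_
    have : (b : X) ∉ A := fun hbA => hx ⟨b, hbA, b.2⟩
    simp [this]

variable [MeasurableSpace X] [StandardBorelSpace X] {m : Measure X}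

/-- On the set where the fibre meets `A`, the fibre sum has one term, bounded by `g ∘ τ`. The
hypothesis `hC` says that the push-forward under `τ` of the measure restricted to this set is at
most `C • m`, so `g ∘ τ` is square integrable there. -/
theorem memLp_fiberSum_indicator_one (hσ : Measurable σ) (hk : Measurable (Function.uncurry k))
    {A : Set X} (hA : MeasurableSet A) (hinj : InjOn σ A) {c : X → X} (hcm : Measurable c)
    (hc : ∀ x ∈ A, c (σ x) = x) {g : X → ℂ} (hg : MemLp g 2 m) {τ : X → X} (hτ : Measurable τ)
    (hbound : ∀ x, ‖k x (c (σ x))‖ ≤ ‖g (τ x)‖) {C : ℝ≥0}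
    (hC : ∀ E, MeasurableSet E → m ((σ ⁻¹' (σ '' A)) ∩ τ ⁻¹' E) ≤ C * m E) :
    MemLp (fiberSum σ k (A.indicator 1)) 2 m := by
  have hD : MeasurableSet (σ ⁻¹' (σ '' A)) := hσ (hA.image_of_measurable_injOn hσ hinj)
  rw [fiberSum_indicator_one hinj hc]
  have hle : Measure.map τ (m.restrict (σ ⁻¹' (σ '' A))) ≤ (C : ℝ≥0∞) • m := by
    refine Measure.le_iff.2 fun E hE => ?_
    rw [Measure.map_apply hτ hE, Measure.restrict_apply (hτ hE), inter_comm, Measure.smul_apply,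
      smul_eq_mul]
    exact hC E hE
  have h1 : MemLp (g ∘ τ) 2 (m.restrict (σ ⁻¹' (σ '' A))) :=
    (hg.of_measure_le_smul ENNReal.coe_ne_top hle).comp_of_map hτ.aemeasurable
  refine (memLp_indicator_iff_restrict hD).2 (h1.of_le ?_ (Eventually.of_forall hbound))
  exact (hk.comp (measurable_id.prodMk (hcm.comp hσ))).aestronglyMeasurable

end FiberSumIndicator

/-! ### Associativity and the operators of convolvers. -/

namespace DiscreteBorelGroupoid

variable {G : Type*} [MeasurableSpace G] {𝒢 : DiscreteBorelGroupoid G} {μ : Measure G}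

/-- Associativity of the convolution with the indicator function of a bisection in the middle. -/
theorem conv_conv_indicator (ω : 𝒢.Cocycle) {B : Set G} (hs : InjOn 𝒢.src B)
    (ht : InjOn 𝒢.tgt B) (f h : G → ℂ) (x : G) :
    conv ω f (conv ω (B.indicator 1) h) x = conv ω (conv ω f (B.indicator 1)) h x := by
  -- Both sides are sums over triples with product `x` and middle factor in `B`: such a factor is
  -- determined by its target, hence by `a`, and by its source, hence by `c`. The reindexing is
  -- along injections whose ranges contain the supports, so no convergence is required.
  let Q := {q : G × G × G // q.2.1 ∈ B ∧ 𝒢.src q.1 = 𝒢.tgt q.2.1 ∧ 𝒢.src q.2.1 = 𝒢.tgt q.2.2 ∧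
    𝒢.mul q.1 (𝒢.mul q.2.1 q.2.2) = x}
  let i : Q → 𝒢.factorizations x := fun q => ⟨(q.1.1, 𝒢.mul q.1.2.1 q.1.2.2),
    q.2.2.1.trans (𝒢.tgt_mul _ _ q.2.2.2.1).symm, q.2.2.2.2⟩
  let j : Q → 𝒢.factorizations x := fun q => ⟨(𝒢.mul q.1.1 q.1.2.1, q.1.2.2),
    (𝒢.src_mul _ _ q.2.2.1).trans q.2.2.2.1,
    (𝒢.mul_assoc _ _ _ q.2.2.1 q.2.2.2.1).trans q.2.2.2.2⟩
  have hi : Function.Injective i := by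
    rintro ⟨⟨a, b, c⟩, hb, h1, h2, h3⟩ ⟨⟨a', b', c'⟩, hb', h1', h2', h3'⟩ heq
    dsimp only at hb h1 h2 hb' h1' h2'
    obtain rfl : a = a' := congrArg (fun p => p.1.1) heq
    replace heq : 𝒢.mul b c = 𝒢.mul b' c' := congrArg (fun p => p.1.2) heq
    obtain rfl : b = b' := ht hb hb' (h1.symm.trans h1')
    obtain rfl : c = c' := by rw [← inv_mul_mul_cancel h2, heq, inv_mul_mul_cancel h2']
    rfl
  have hj : Function.Injective j := by
    rintro ⟨⟨a, b, c⟩, hb, h1, h2, h3⟩ ⟨⟨a', b', c'⟩, hb', h1', h2', h3'⟩ heq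
    dsimp only at hb h1 h2 hb' h1' h2'
    obtain rfl : c = c' := congrArg (fun p => p.1.2) heq
    replace heq : 𝒢.mul a b = 𝒢.mul a' b' := congrArg (fun p => p.1.1) heq
    obtain rfl : b = b' := hs hb hb' (h2.trans h2'.symm)
    obtain rfl : a = a' := by rw [← mul_mul_inv_cancel h1, heq, mul_mul_inv_cancel h1']
    rfl
  have hL : conv ω f (conv ω (B.indicator 1) h) x =
      ∑' q : Q, (ω.toFun (i q).1.1 (i q).1.2 : ℂ) * f (i q).1.1 *
        conv ω (B.indicator 1) h (i q).1.2 := by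
    refine (hi.tsum_eq fun p hp => ?_).symm
    obtain ⟨⟨a, d⟩, h1, h2⟩ := p
    simp only at h1 h2
    have hd : conv ω (B.indicator 1) h d ≠ 0 := fun h0 => hp (by simp [h0])
    obtain ⟨⟨⟨b, c⟩, h3, h4⟩, hbc⟩ : ∃ r : 𝒢.factorizations d,
        (ω.toFun r.1.1 r.1.2 : ℂ) * B.indicator 1 r.1.1 * h r.1.2 ≠ 0 := by
      by_contra! hall
      exact hd ((tsum_congr hall).trans tsum_zero)
    simp only at h3 h4
    have hbB : b ∈ B := by by_contra hb; exact hbc (by simp [hb])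
    subst h4
    exact ⟨⟨(a, b, c), hbB, h1.trans (𝒢.tgt_mul _ _ h3), h3, h2⟩, rfl⟩
  have hR : conv ω (conv ω f (B.indicator 1)) h x =
      ∑' q : Q, (ω.toFun (j q).1.1 (j q).1.2 : ℂ) * conv ω f (B.indicator 1) (j q).1.1 *
        h (j q).1.2 := by
    refine (hj.tsum_eq fun p hp => ?_).symm
    obtain ⟨⟨d, c⟩, h1, h2⟩ := p
    simp only at h1 h2
    have hd : conv ω f (B.indicator 1) d ≠ 0 := fun h0 => hp (by simp [h0])
    obtain ⟨⟨⟨a, b⟩, h3, h4⟩, hbc⟩ : ∃ r : 𝒢.factorizations d,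
        (ω.toFun r.1.1 r.1.2 : ℂ) * f r.1.1 * B.indicator 1 r.1.2 ≠ 0 := by
      by_contra! hall
      exact hd ((tsum_congr hall).trans tsum_zero)
    simp only at h3 h4
    have hbB : b ∈ B := by by_contra hb; exact hbc (by simp [hb])
    subst h4
    have h5 : 𝒢.src b = 𝒢.tgt c := (𝒢.src_mul _ _ h3).symm.trans h1
    exact ⟨⟨(a, b, c), hbB, h3, h5, (𝒢.mul_assoc _ _ _ h3 h5).symm.trans h2⟩, rfl⟩
  rw [hL, hR]
  refine tsum_congr ?_
  rintro ⟨⟨a, b, c⟩, hb, h1, h2, h3⟩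
  simp only [i, j]
  rw [conv_indicator_left ω ht h hb h2, conv_indicator_right ω hs f hb h1]
  -- The two phases of the term at `(a, b, c)` agree by the cocycle identity.
  have := congrArg (fun z : Circle => (z : ℂ)) (ω.cocycle a b c h1 h2)
  simp only [Circle.coe_mul] at this
  linear_combination (f a * h c) * this

/-- The normalization of the cocycle at units makes the indicator of the unit space a right identity
here. Evaluation at this vector is what recovers a convolver from its operator. -/
theorem conv_indicator_units (ω : 𝒢.Cocycle) {B : Set G} (hB : InjOn 𝒢.tgt B) :
    conv ω (B.indicator 1) (𝒢.units.indicator 1) = B.indicator 1 := by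
  ext x
  by_cases hx : x ∈ B
  · have h := conv_indicator_left ω hB (𝒢.units.indicator 1) hx (𝒢.tgt_src x).symm
    rw [𝒢.mul_src_self, ω.map_src, indicator_of_mem (show 𝒢.src x ∈ 𝒢.units from 𝒢.src_src x)] at h
    rw [h, indicator_of_mem hx]
    simp
  · rw [indicator_of_notMem hx]
    refine conv_indicator_indicator_of_notMem ω ?_
    rintro ⟨b, hb, e, he, hbe, rfl⟩
    have he' : 𝒢.src e = e := he
    rw [← he', 𝒢.tgt_src, he'] at hbe
    rw [← hbe, 𝒢.mul_src_self] at hx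
    exact hx hb

theorem conv_units_indicator (ω : 𝒢.Cocycle) {B : Set G} (hB : InjOn 𝒢.src B) :
    conv ω (𝒢.units.indicator 1) (B.indicator 1) = B.indicator 1 := by
  ext x
  by_cases hx : x ∈ B
  · have h := conv_indicator_right ω hB (𝒢.units.indicator 1) hx (𝒢.src_tgt x)
    rw [𝒢.tgt_mul_self, ω.map_tgt, indicator_of_mem (show 𝒢.tgt x ∈ 𝒢.units from 𝒢.src_tgt x)] at h
    rw [h, indicator_of_mem hx]
    simp
  · rw [indicator_of_notMem hx]
    refine conv_indicator_indicator_of_notMem ω ?_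
    rintro ⟨e, he, b, hb, heb, rfl⟩
    have he' : 𝒢.src e = e := he
    rw [he'] at heb
    rw [heb, 𝒢.tgt_mul_self] at hx
    exact hx hb

variable [StandardBorelSpace G]

theorem IsMeasured.fiberAE_src (hμ : 𝒢.IsMeasured μ) : FiberAE 𝒢.src (𝒢.muS μ) :=
  fun _ h => hμ.ae_src h

theorem IsMeasured.fiberAE_tgt (hμ : 𝒢.IsMeasured μ) : FiberAE 𝒢.tgt (𝒢.muS μ) :=
  fun _ h => hμ.ae_tgt h

/-- The first factor shares its target with `x` and the second its source. Null sets are avoided on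
almost every fibre of either kind, so convolution is well defined on L² classes. -/
theorem IsMeasured.ae_factorizations (hμ : 𝒢.IsMeasured μ) {f f' g g' : G → ℂ}
    (hf : f =ᵐ[𝒢.muS μ] f') (hg : g =ᵐ[𝒢.muS μ] g') :
    ∀ᵐ x ∂(𝒢.muS μ), ∀ p : 𝒢.factorizations x, f p.1.1 = f' p.1.1 ∧ g p.1.2 = g' p.1.2 := by
  filter_upwards [hμ.ae_tgt hf, hμ.ae_src hg] with x hx hx' p
  exact ⟨hx _ (𝒢.factorizationsEquivTgt x p).2, hx' _ (𝒢.factorizationsEquivSrc x p).2⟩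

theorem IsMeasured.conv_ae_eq (hμ : 𝒢.IsMeasured μ) (ω : 𝒢.Cocycle) {f f' g g' : G → ℂ}
    (hf : f =ᵐ[𝒢.muS μ] f') (hg : g =ᵐ[𝒢.muS μ] g') :
    conv ω f g =ᵐ[𝒢.muS μ] conv ω f' g' := by
  filter_upwards [hμ.ae_factorizations hf hg] with x hx
  exact tsum_congr fun p => by rw [(hx p).1, (hx p).2]

theorem IsMeasured.convMemL2_congr (hμ : 𝒢.IsMeasured μ) {ω : 𝒢.Cocycle} {f f' g g' : G → ℂ}
    (hf : f =ᵐ[𝒢.muS μ] f') (hg : g =ᵐ[𝒢.muS μ] g') (h : ConvMemL2 μ ω f g) :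
    ConvMemL2 μ ω f' g' := by
  refine ⟨?_, h.2.ae_eq (hμ.conv_ae_eq ω hf hg)⟩
  filter_upwards [h.1, hμ.ae_factorizations hf hg] with x hx hx'
  exact hx.congr fun p => by rw [(hx' p).1, (hx' p).2]

theorem IsMeasured.existsUnique_isLeftConv (hμ : 𝒢.IsMeasured μ) {ω : 𝒢.Cocycle} {f : 𝒢.L2 μ}
    (hf : IsLeftConvolver μ ω f) : ∃! T, IsLeftConv μ ω f T := by
  obtain ⟨T, hT⟩ := hμ.fiberAE_src.exists_continuousLinearMap (k := leftKernel ω f) fun g =>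
    ⟨by filter_upwards [(hf g).1] with x hx using (summable_conv_iff_src ω f g x).1 hx,
      (funext (conv_eq_fiberSum_src ω f g)) ▸ (hf g).2⟩
  have hT' : IsLeftConv μ ω f T := fun g => by
    rw [funext (conv_eq_fiberSum_src ω f g)]
    exact hT g
  exact ⟨T, hT', fun S hS => ContinuousLinearMap.ext fun g =>
    Lp.ext ((hS g).trans (hT' g).symm)⟩

theorem IsMeasured.existsUnique_isRightConv (hμ : 𝒢.IsMeasured μ) {ω : 𝒢.Cocycle} {f : 𝒢.L2 μ}
    (hf : IsRightConvolver μ ω f) : ∃! T, IsRightConv μ ω f T := by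
  obtain ⟨T, hT⟩ := hμ.fiberAE_tgt.exists_continuousLinearMap (k := rightKernel ω.conj f) fun g =>
    ⟨by filter_upwards [(hf g).1] with x hx using (summable_conv_iff_tgt ω.conj f g x).1 hx,
      (funext (conv_eq_fiberSum_tgt ω.conj f g)) ▸ (hf g).2⟩
  have hT' : IsRightConv μ ω f T := fun g => by
    rw [funext (conv_eq_fiberSum_tgt ω.conj f g)]
    exact hT g
  exact ⟨T, hT', fun S hS => ContinuousLinearMap.ext fun g =>
    Lp.ext ((hS g).trans (hT' g).symm)⟩

/-- An operator that acts as left convolution by `f` on enough indicator functions is `L_f`. -/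
theorem IsMeasured.isLeftConv_of_cover (hμ : 𝒢.IsMeasured μ) {ω : 𝒢.Cocycle} {f : 𝒢.L2 μ}
    {T : 𝒢.L2 μ →L[ℂ] 𝒢.L2 μ} {B : ℕ → Set G} (hB : ∀ n, 𝒢.IsBorelBisection (B n))
    (hcov : ∀ᵐ x ∂(𝒢.muS μ), ∃ n, x ∈ B n)
    (hT : ∀ n (E : Set G) (hE : MeasurableSet E) (hfin : 𝒢.muS μ E ≠ ∞), E ⊆ B n →
      T (indicatorConstLp 2 hE hfin 1) =ᵐ[𝒢.muS μ] conv ω f (E.indicator 1)) :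
    IsLeftConvolver μ ω f ∧ IsLeftConv μ ω f T := by
  have key := hμ.fiberAE_src.apply_eq_fiberSum 𝒢.measurable_src
    (measurable_leftKernel ω (Lp.stronglyMeasurable f).measurable)
    (fun n => (hB n).measurableSet) (fun n => (hB n).injOn_src) hcov (T := T)
    fun n E hE hfin hsub => by
      rw [← funext (conv_eq_fiberSum_src ω f _)]
      exact hT n E hE hfin hsub
  have hTg : IsLeftConv μ ω f T := fun g => by
    rw [funext (conv_eq_fiberSum_src ω f g)]
    exact (key g).2
  refine ⟨fun g => ⟨?_, (Lp.memLp (T g)).ae_eq (hTg g)⟩, hTg⟩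
  filter_upwards [(key g).1] with x hx using (summable_conv_iff_src ω f g x).2 hx

/-- An operator that acts as right convolution by `f` on enough indicator functions is `R_f`. -/
theorem IsMeasured.isRightConv_of_cover (hμ : 𝒢.IsMeasured μ) {ω : 𝒢.Cocycle} {f : 𝒢.L2 μ}
    {T : 𝒢.L2 μ →L[ℂ] 𝒢.L2 μ} {B : ℕ → Set G} (hB : ∀ n, 𝒢.IsBorelBisection (B n))
    (hcov : ∀ᵐ x ∂(𝒢.muS μ), ∃ n, x ∈ B n)
    (hT : ∀ n (E : Set G) (hE : MeasurableSet E) (hfin : 𝒢.muS μ E ≠ ∞), E ⊆ B n →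
      T (indicatorConstLp 2 hE hfin 1) =ᵐ[𝒢.muS μ] conv ω (E.indicator 1) f) :
    IsRightConvolver μ ω.conj f ∧ IsRightConv μ ω.conj f T := by
  have key := hμ.fiberAE_tgt.apply_eq_fiberSum 𝒢.measurable_tgt
    (measurable_rightKernel ω (Lp.stronglyMeasurable f).measurable)
    (fun n => (hB n).measurableSet) (fun n => (hB n).injOn_tgt) hcov (T := T)
    fun n E hE hfin hsub => by
      rw [← funext (conv_eq_fiberSum_tgt ω f _)]
      exact hT n E hE hfin hsub
  have hTg : ∀ g : 𝒢.L2 μ, T g =ᵐ[𝒢.muS μ] conv ω g f := fun g => by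
    rw [funext (conv_eq_fiberSum_tgt ω f g)]
    exact (key g).2
  simp only [IsRightConvolver, IsRightConv, ω.conj_conj]
  refine ⟨fun g => ⟨?_, (Lp.memLp (T g)).ae_eq (hTg g)⟩, hTg⟩
  filter_upwards [(key g).1] with x hx using (summable_conv_iff_tgt ω f g x).2 hx

/-- The operators `L_f` and `R_h` commute. -/
theorem IsMeasured.commute_leftConv_rightConv (hμ : 𝒢.IsMeasured μ) {ω : 𝒢.Cocycle} {f h : 𝒢.L2 μ}
    {T S : 𝒢.L2 μ →L[ℂ] 𝒢.L2 μ} (hT : IsLeftConv μ ω f T) (hS : IsRightConv μ ω.conj h S) :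
    T * S = S * T := by
  simp only [IsRightConv, ω.conj_conj] at hS
  obtain ⟨B, hB, hcov⟩ := hμ.exists_bisection_cover
  -- It is enough to test on indicators of subsets of bisections, where associativity holds
  -- unconditionally.
  refine Lp_ext_of_cover (fun n => (hB n).measurableSet) hcov fun n E hE hfin hsub => Lp.ext ?_
  have hEB := (hB n).mono hsub hE
  have hone : indicatorConstLp 2 hE hfin (1 : ℂ) =ᵐ[𝒢.muS μ] E.indicator 1 :=
    indicatorConstLp_coeFn
  have h1 := (hT (S (indicatorConstLp 2 hE hfin 1))).trans (hμ.conv_ae_eq ω (EventuallyEq.refl _ _)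
    ((hS _).trans (hμ.conv_ae_eq ω hone (EventuallyEq.refl _ _))))
  have h2 := (hS (T (indicatorConstLp 2 hE hfin 1))).trans (hμ.conv_ae_eq ω
    ((hT _).trans (hμ.conv_ae_eq ω (EventuallyEq.refl _ _) hone)) (EventuallyEq.refl _ _))
  rw [← funext (conv_conv_indicator ω hEB.injOn_src hEB.injOn_tgt f h)] at h2
  exact h1.trans h2.symm

end DiscreteBorelGroupoid

namespace DiscreteBorelGroupoid

variable {G : Type*} [MeasurableSpace G] [StandardBorelSpace G] {𝒢 : DiscreteBorelGroupoid G}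
  {μ : Measure G}

/-! ### The operators `λ_A` and `ρ_A` -/

theorem IsMeasured.muS_apply (hμ : 𝒢.IsMeasured μ) {A : Set G} (hA : MeasurableSet A) :
    𝒢.muS μ A = ∫⁻ y, Measure.count (A ∩ 𝒢.src ⁻¹' {y}) ∂μ :=
  have := hμ.isProbabilityMeasure
  bind_count_fiber_apply 𝒢.measurable_src 𝒢.countable_src_fiber hA

theorem IsMeasured.aemeasurable_count_src (hμ : 𝒢.IsMeasured μ) {A : Set G}
    (hA : MeasurableSet A) : AEMeasurable (fun y => Measure.count (A ∩ 𝒢.src ⁻¹' {y})) μ := by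
  have := hμ.isProbabilityMeasure
  refine ((Measure.measurable_coe hA).comp_aemeasurable (aemeasurable_count_restrict_fiber (μ := μ)
    𝒢.measurable_src 𝒢.countable_src_fiber)).congr ?_
  exact Eventually.of_forall fun y => Measure.restrict_apply hA

theorem count_le_count_of_injOn {X : Type*} [MeasurableSpace X] {s t : Set X}
    (hs : MeasurableSet s) (ht : MeasurableSet t) {τ : X → X} (hmaps : MapsTo τ s t)
    (hinj : InjOn τ s) : (Measure.count s : ℝ≥0∞) ≤ Measure.count t := by
  rw [Measure.count_apply hs, Measure.count_apply ht]
  exact_mod_cast encard_le_encard_of_injOn hmaps hinj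

/-- Left translation by `A⁻¹` does not increase `μ_s`; it is written in terms of a section `c` of
the target map with values in `A`. -/
theorem IsMeasured.muS_preimage_le (hμ : 𝒢.IsMeasured μ) {A : Set G}
    (hA : 𝒢.IsBorelBisection A) {c : G → G} (hcm : Measurable c)
    (hc : ∀ x ∈ A, c (𝒢.tgt x) = x) {E : Set G} (hE : MeasurableSet E) :
    𝒢.muS μ (𝒢.tgt ⁻¹' (𝒢.tgt '' A) ∩
      (fun x => 𝒢.mulExt (𝒢.inv (c (𝒢.tgt x)), x)) ⁻¹' E) ≤ 𝒢.muS μ E := by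
  have hτ : Measurable fun x => 𝒢.mulExt (𝒢.inv (c (𝒢.tgt x)), x) :=
    measurable_mulExt.comp
      ((𝒢.measurable_inv.comp (hcm.comp 𝒢.measurable_tgt)).prodMk measurable_id)
  have hD : MeasurableSet (𝒢.tgt ⁻¹' (𝒢.tgt '' A)) := 𝒢.measurable_tgt
    (hA.measurableSet.image_of_measurable_injOn 𝒢.measurable_tgt hA.injOn_tgt)
  have hfib : ∀ y, MeasurableSet (𝒢.src ⁻¹' {y}) := fun y =>
    𝒢.measurable_src (measurableSet_singleton y)
  have hval : ∀ x ∈ 𝒢.tgt ⁻¹' (𝒢.tgt '' A), c (𝒢.tgt x) ∈ A ∧ 𝒢.tgt (c (𝒢.tgt x)) = 𝒢.tgt x ∧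
      𝒢.mulExt (𝒢.inv (c (𝒢.tgt x)), x) = 𝒢.mul (𝒢.inv (c (𝒢.tgt x))) x := by
    rintro x ⟨a, ha, hax⟩
    rw [← hax, hc a ha]
    exact ⟨ha, rfl, mulExt_apply (by rw [𝒢.src_inv, hax])⟩
  rw [hμ.muS_apply (hD.inter (hτ hE)), hμ.muS_apply hE]
  -- Left multiplication by the inverse of an element of `A` keeps the source and is injective, so
  -- it can be compared fibre by fibre.
  refine lintegral_mono fun y => count_le_count_of_injOn ((hD.inter (hτ hE)).inter (hfib y))
    (hE.inter (hfib y)) (τ := fun x => 𝒢.mulExt (𝒢.inv (c (𝒢.tgt x)), x)) ?_ ?_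
  · rintro x ⟨⟨hxD, hxE⟩, hxy⟩
    obtain ⟨-, h2, h3⟩ := hval x hxD
    refine ⟨hxE, ?_⟩
    simp only [mem_preimage, h3, src_inv_mul h2]
    exact hxy
  · rintro x ⟨⟨hxD, -⟩, -⟩ x' ⟨⟨hxD', -⟩, -⟩ heq
    obtain ⟨h1, h2, h3⟩ := hval x hxD
    obtain ⟨h1', h2', h3'⟩ := hval x' hxD'
    simp only [h3, h3'] at heq
    have hcc : c (𝒢.tgt x) = c (𝒢.tgt x') :=
      hA.injOn_src h1 h1' (by rw [← tgt_inv_mul h2, heq, tgt_inv_mul h2'])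
    rw [← mul_mul_inv_mul_cancel h2, heq, hcc, mul_mul_inv_mul_cancel h2']

/-- Left translation moves arrows inside source fibres, so the constant 1 works for every bisection.
-/
theorem IsMeasured.convMemL2_indicator_left (hμ : 𝒢.IsMeasured μ) (ω : 𝒢.Cocycle) {A : Set G}
    (hA : 𝒢.IsBorelBisection A) (g : 𝒢.L2 μ) : ConvMemL2 μ ω (A.indicator 1) g := by
  constructor
  · refine Eventually.of_forall fun x => (summable_conv_iff_tgt ω g _ x).2 ?_
    exact fiberSummable_indicator (Subsingleton.finite fun b hb b' hb' =>
      hA.injOn_tgt hb.2 hb'.2 (hb.1.trans hb'.1.symm)) _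
  · obtain ⟨c, hcm, hc⟩ := exists_measurable_section 𝒢.measurable_tgt hA.measurableSet hA.injOn_tgt
    rw [funext (conv_eq_fiberSum_tgt ω g (A.indicator 1))]
    refine memLp_fiberSum_indicator_one 𝒢.measurable_tgt
      (measurable_rightKernel ω (Lp.stronglyMeasurable g).measurable) hA.measurableSet hA.injOn_tgt
      hcm hc (Lp.memLp g) (τ := fun x => 𝒢.mulExt (𝒢.inv (c (𝒢.tgt x)), x))
      (measurable_mulExt.comp
        ((𝒢.measurable_inv.comp (hcm.comp 𝒢.measurable_tgt)).prodMk measurable_id))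
      (fun x => ?_) (C := 1) fun E hE => ?_
    · rw [rightKernel, norm_mul]
      exact mul_le_of_le_one_left (norm_nonneg _) (ω.norm_ext_le _)
    · rw [ENNReal.coe_one, one_mul]
      exact hμ.muS_preimage_le hA hcm hc hE

/-- Right translation changes the source, and the weight of the fibres with it; hence the extra
bound. -/
theorem convMemL2_indicator_right (ω : 𝒢.Cocycle) {B : Set G}
    (hB : 𝒢.IsBorelBisection B) {C : ℝ≥0}
    (hC : ∀ E, MeasurableSet E → 𝒢.muS μ (𝒢.setMul E B) ≤ C * 𝒢.muS μ E) (g : 𝒢.L2 μ) :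
    ConvMemL2 μ ω g (B.indicator 1) := by
  constructor
  · refine Eventually.of_forall fun x => (summable_conv_iff_src ω g _ x).2 ?_
    exact fiberSummable_indicator (Subsingleton.finite fun b hb b' hb' =>
      hB.injOn_src hb.2 hb'.2 (hb.1.trans hb'.1.symm)) _
  · obtain ⟨c, hcm, hc⟩ := exists_measurable_section 𝒢.measurable_src hB.measurableSet hB.injOn_src
    rw [funext (conv_eq_fiberSum_src ω g (B.indicator 1))]
    refine memLp_fiberSum_indicator_one 𝒢.measurable_src
      (measurable_leftKernel ω (Lp.stronglyMeasurable g).measurable) hB.measurableSet hB.injOn_src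
      hcm hc (Lp.memLp g) (τ := fun x => 𝒢.mulExt (x, 𝒢.inv (c (𝒢.src x))))
      (measurable_mulExt.comp
        (measurable_id.prodMk (𝒢.measurable_inv.comp (hcm.comp 𝒢.measurable_src))))
      (fun x => ?_) (C := C) fun E hE => ?_
    · rw [leftKernel, norm_mul]
      exact mul_le_of_le_one_left (norm_nonneg _) (ω.norm_ext_le _)
    · refine le_trans (measure_mono ?_) (hC E hE)
      rintro x ⟨⟨b, hb, hbx⟩, hxE⟩
      rw [mem_preimage, ← hbx, hc b hb, mulExt_apply (by rw [𝒢.tgt_inv, hbx])] at hxE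
      exact ⟨_, hxE, b, hb, src_mul_inv hbx, mul_inv_mul_cancel hbx⟩

theorem indicatorConstLp_one_ae_eq {X : Type*} [MeasurableSpace X] {m : Measure X} {E : Set X}
    (hE : MeasurableSet E) (hfin : m E ≠ ∞) :
    indicatorConstLp 2 hE hfin (1 : ℂ) =ᵐ[m] E.indicator 1 :=
  indicatorConstLp_coeFn

theorem IsMeasured.existsUnique_isLeftTranslation (hμ : 𝒢.IsMeasured μ) (ω : 𝒢.Cocycle) {A : Set G}
    (hA : 𝒢.IsBorelBisection A) : ∃! T, IsLeftTranslation μ ω A T := by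
  have hone := indicatorConstLp_one_ae_eq hA.measurableSet (hA.muS_ne_top hμ)
  obtain ⟨T, hT, -⟩ := hμ.existsUnique_isLeftConv (ω := ω)
    (f := indicatorConstLp 2 hA.measurableSet (hA.muS_ne_top hμ) 1) fun g =>
      hμ.convMemL2_congr hone.symm (EventuallyEq.refl _ _) (hμ.convMemL2_indicator_left ω hA g)
  refine ⟨T, (isLeftTranslation_iff hA).2 fun E hE hfin => (hT _).trans
    (hμ.conv_ae_eq ω hone (indicatorConstLp_one_ae_eq hE hfin)), fun S hS => ?_⟩
  refine Lp_ext_of_indicator fun E hE hfin => Lp.ext ?_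
  exact ((isLeftTranslation_iff hA).1 hS E hE hfin).trans ((hT _).trans
    (hμ.conv_ae_eq ω hone (indicatorConstLp_one_ae_eq hE hfin))).symm

theorem IsMeasured.existsUnique_isRightTranslation (hμ : 𝒢.IsMeasured μ) (ω : 𝒢.Cocycle)
    {A : Set G} (hA : 𝒢.IsBorelBisection A) {C : ℝ≥0}
    (hC : ∀ E, MeasurableSet E → 𝒢.muS μ (𝒢.setMul E (𝒢.setInv A)) ≤ C * 𝒢.muS μ E) :
    ∃! T, IsRightTranslation μ ω.conj A T := by
  have hA' := hA.setInv
  have hone := indicatorConstLp_one_ae_eq hA'.measurableSet (hA'.muS_ne_top hμ)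
  obtain ⟨T, hT, -⟩ := hμ.existsUnique_isRightConv (ω := ω.conj)
    (f := indicatorConstLp 2 hA'.measurableSet (hA'.muS_ne_top hμ) 1) fun g => by
      rw [ω.conj_conj]
      exact hμ.convMemL2_congr (EventuallyEq.refl _ _) hone.symm
        (convMemL2_indicator_right ω hA' hC g)
  simp only [IsRightConv, ω.conj_conj] at hT
  refine ⟨T, (isRightTranslation_conj_iff hA).2 fun E hE hfin => (hT _).trans
    (hμ.conv_ae_eq ω (indicatorConstLp_one_ae_eq hE hfin) hone), fun S hS => ?_⟩
  refine Lp_ext_of_indicator fun E hE hfin => Lp.ext ?_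
  exact ((isRightTranslation_conj_iff hA).1 hS E hE hfin).trans ((hT _).trans
    (hμ.conv_ae_eq ω (indicatorConstLp_one_ae_eq hE hfin) hone)).symm

theorem IsMeasured.isLeftConv_of_isLeftTranslation (hμ : 𝒢.IsMeasured μ) {ω : 𝒢.Cocycle}
    {A : Set G} (hA : 𝒢.IsBorelBisection A) {T : 𝒢.L2 μ →L[ℂ] 𝒢.L2 μ}
    (hT : IsLeftTranslation μ ω A T) :
    IsLeftConvolver μ ω (indicatorConstLp 2 hA.measurableSet (hA.muS_ne_top hμ) 1) ∧
      IsLeftConv μ ω (indicatorConstLp 2 hA.measurableSet (hA.muS_ne_top hμ) 1) T := by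
  obtain ⟨B, hB, hcov⟩ := hμ.exists_bisection_cover
  exact hμ.isLeftConv_of_cover hB hcov fun n E hE hfin _ =>
    ((isLeftTranslation_iff hA).1 hT E hE hfin).trans (hμ.conv_ae_eq ω
      (indicatorConstLp_one_ae_eq _ _).symm (EventuallyEq.refl _ _))

theorem IsMeasured.isRightConv_of_isRightTranslation (hμ : 𝒢.IsMeasured μ) {ω : 𝒢.Cocycle}
    {A : Set G} (hA : 𝒢.IsBorelBisection A) {T : 𝒢.L2 μ →L[ℂ] 𝒢.L2 μ}
    (hT : IsRightTranslation μ ω.conj A T) :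
    IsRightConvolver μ ω.conj
        (indicatorConstLp 2 hA.setInv.measurableSet (hA.setInv.muS_ne_top hμ) 1) ∧
      IsRightConv μ ω.conj
        (indicatorConstLp 2 hA.setInv.measurableSet (hA.setInv.muS_ne_top hμ) 1) T := by
  obtain ⟨B, hB, hcov⟩ := hμ.exists_bisection_cover
  exact hμ.isRightConv_of_cover hB hcov fun n E hE hfin _ =>
    ((isRightTranslation_conj_iff hA).1 hT E hE hfin).trans (hμ.conv_ae_eq ω
      (EventuallyEq.refl _ _) (indicatorConstLp_one_ae_eq _ _).symm)

/-! ### Bisections with bounded right translation -/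

/-- At most one `b ∈ B` has a given source, and right multiplication by its inverse carries that
source fibre of `E · B` injectively into the part of `E` with source `tgt b`. -/
theorem IsMeasured.muS_setMul_le (hμ : 𝒢.IsMeasured μ) {B E : Set G} (hB : 𝒢.IsBorelBisection B)
    (hE : MeasurableSet E) :
    𝒢.muS μ (𝒢.setMul E B) ≤
      ∫⁻ b in B, Measure.count (E ∩ 𝒢.src ⁻¹' {𝒢.tgt b}) ∂(𝒢.muS μ) := by
  have := hμ.isProbabilityMeasure
  have hfib : ∀ y, MeasurableSet (𝒢.src ⁻¹' {y}) := fun y =>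
    𝒢.measurable_src (measurableSet_singleton y)
  obtain ⟨c, hcm, hc⟩ := exists_measurable_section 𝒢.measurable_src hB.measurableSet hB.injOn_src
  have hset : 𝒢.setMul E B = 𝒢.src ⁻¹' (𝒢.src '' B) ∩
      (fun x => 𝒢.mulExt (x, 𝒢.inv (c (𝒢.src x)))) ⁻¹' E := by
    ext x
    constructor
    · rintro ⟨e, he, b, hb, heb, rfl⟩
      have hs : 𝒢.src (𝒢.mul e b) = 𝒢.src b := 𝒢.src_mul _ _ heb
      refine ⟨⟨b, hb, hs.symm⟩, ?_⟩
      rw [mem_preimage, hs, hc b hb, mulExt_apply (by rw [𝒢.tgt_inv, hs]), mul_mul_inv_cancel heb]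
      exact he
    · rintro ⟨⟨b, hb, hbx⟩, hxE⟩
      rw [mem_preimage, ← hbx, hc b hb, mulExt_apply (by rw [𝒢.tgt_inv, hbx])] at hxE
      exact ⟨_, hxE, b, hb, src_mul_inv hbx, mul_inv_mul_cancel hbx⟩
  have hmeas : MeasurableSet (𝒢.setMul E B) := by
    rw [hset]
    exact (𝒢.measurable_src (hB.measurableSet.image_of_measurable_injOn 𝒢.measurable_src
      hB.injOn_src)).inter ((measurable_mulExt.comp
        (measurable_id.prodMk (𝒢.measurable_inv.comp (hcm.comp 𝒢.measurable_src)))) hE)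
  have hNt : AEMeasurable (fun b => Measure.count (E ∩ 𝒢.src ⁻¹' {𝒢.tgt b})) (𝒢.muS μ) := by
    obtain ⟨N, hN, hae⟩ := hμ.aemeasurable_count_src hE
    refine ⟨N ∘ 𝒢.tgt, hN.comp 𝒢.measurable_tgt, ?_⟩
    refine hμ.ae_muS_iff_ae_muT.2 (hμ.ae_muT_iff.2 ?_)
    filter_upwards [hae] with y hy x hx
    rw [hx, hy, Function.comp_apply, hx]
  rw [hμ.muS_apply hmeas, ← lintegral_indicator hB.measurableSet]
  unfold muS
  rw [Measure.lintegral_bind (aemeasurable_count_restrict_fiber 𝒢.measurable_src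
    𝒢.countable_src_fiber) (hNt.indicator hB.measurableSet)]
  refine lintegral_mono fun y => ?_
  rcases (𝒢.setMul E B ∩ 𝒢.src ⁻¹' {y}).eq_empty_or_nonempty with h0 | ⟨x₀, hx₀, hx₀y⟩
  · rw [h0, measure_empty]; exact zero_le
  obtain ⟨e, he, b, hb, heb, rfl⟩ := hx₀
  have hby : 𝒢.src b = y := (𝒢.src_mul _ _ heb).symm.trans hx₀y
  have hcount : (Measure.count (𝒢.setMul E B ∩ 𝒢.src ⁻¹' {y}) : ℝ≥0∞) ≤
      Measure.count (E ∩ 𝒢.src ⁻¹' {𝒢.tgt b}) := by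
    have hfac : ∀ x ∈ 𝒢.setMul E B ∩ 𝒢.src ⁻¹' {y}, ∃ e' ∈ E, 𝒢.src e' = 𝒢.tgt b ∧
        𝒢.mul e' b = x := by
      rintro x ⟨⟨e', he', b', hb', heb', rfl⟩, hxy⟩
      obtain rfl : b' = b :=
        hB.injOn_src hb' hb (((𝒢.src_mul _ _ heb').symm.trans hxy).trans hby.symm)
      exact ⟨e', he', heb', rfl⟩
    refine count_le_count_of_injOn (hmeas.inter (hfib y)) (hE.inter (hfib _))
      (τ := fun x => 𝒢.mul x (𝒢.inv b)) ?_ ?_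
    · intro x hx
      obtain ⟨e', he', heb', rfl⟩ := hfac x hx
      simp only [mul_mul_inv_cancel heb']
      exact ⟨he', heb'⟩
    · intro x hx x' hx' heq
      obtain ⟨e', he', heb', rfl⟩ := hfac x hx
      obtain ⟨e'', he'', heb'', rfl⟩ := hfac x' hx'
      simp only [mul_mul_inv_cancel heb', mul_mul_inv_cancel heb''] at heq
      rw [heq]
  refine hcount.trans ?_
  calc (Measure.count (E ∩ 𝒢.src ⁻¹' {𝒢.tgt b}) : ℝ≥0∞)
      = ∫⁻ b in {b}, B.indicator (fun b => Measure.count (E ∩ 𝒢.src ⁻¹' {𝒢.tgt b})) b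
          ∂Measure.count := by
        rw [lintegral_singleton, Measure.count_singleton, mul_one, indicator_of_mem hb]
    _ ≤ _ := lintegral_mono_set
        (singleton_subset_iff.2 (show b ∈ 𝒢.src ⁻¹' {y} from hby))

/-- Almost all of a Borel bisection is a countable union of Borel bisections for which right
translation is bounded. -/
theorem IsMeasured.exists_bounded_cover_of_bisection (hμ : 𝒢.IsMeasured μ) {B : Set G}
    (hB : 𝒢.IsBorelBisection B) :
    ∃ D : ℕ → Set G, (∀ j, D j ⊆ B ∧ MeasurableSet (D j) ∧
      ∀ D' ⊆ D j, MeasurableSet D' → ∃ C : ℝ≥0, ∀ E, MeasurableSet E →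
        𝒢.muS μ (𝒢.setMul E D') ≤ C * 𝒢.muS μ E) ∧
      ∀ᵐ x ∂(𝒢.muS μ), x ∈ B → ∃ j, x ∈ D j := by
  have := hμ.isProbabilityMeasure
  have hfinite : IsFiniteMeasure ((𝒢.muS μ).restrict B) :=
    ⟨by rw [Measure.restrict_apply_univ]; exact (hB.muS_ne_top hμ).lt_top⟩
  -- This measure compares the weights of units before and after right translation by `B`. It is
  -- absolutely continuous with respect to `μ` by non-singularity, and where its density is at most
  -- `j`, right translation is bounded with constant `j`. The bound passes to smaller sets.
  let ν : Measure G := ((𝒢.muS μ).restrict B).map 𝒢.tgt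
  have hνμ : ν ≪ μ := by
    refine Measure.AbsolutelyContinuous.mk fun F hF h0 => ?_
    rw [Measure.map_apply 𝒢.measurable_tgt hF]
    refine Measure.absolutelyContinuous_of_le Measure.restrict_le_self ?_
    have : ∀ᵐ x ∂(𝒢.muS μ), 𝒢.tgt x ∉ F := by
      refine hμ.ae_muS_iff_ae_muT.2 (hμ.ae_muT_iff.2 ?_)
      filter_upwards [measure_eq_zero_iff_ae_notMem.1 h0] with y hy x hx
      rwa [hx]
    exact measure_eq_zero_iff_ae_notMem.2 this
  let r := ν.rnDeriv μ
  have hr : Measurable r := Measure.measurable_rnDeriv ν μ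
  have hDm : ∀ j : ℕ, MeasurableSet (𝒢.tgt ⁻¹' {y | r y ≤ j}) := fun j =>
    𝒢.measurable_tgt (measurableSet_le hr measurable_const)
  refine ⟨fun j => B ∩ 𝒢.tgt ⁻¹' {y | r y ≤ j}, fun j => ⟨inter_subset_left,
    hB.measurableSet.inter (hDm j), fun D' hD' hD'm => ⟨j, fun E hE => ?_⟩⟩, ?_⟩
  · refine (hμ.muS_setMul_le (hB.mono (hD'.trans inter_subset_left) hD'm) hE).trans ?_
    obtain ⟨N, hN, hae⟩ := hμ.aemeasurable_count_src hE
    have hae' : ∀ᵐ b ∂(𝒢.muS μ), Measure.count (E ∩ 𝒢.src ⁻¹' {𝒢.tgt b}) = N (𝒢.tgt b) := by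
      refine hμ.ae_muS_iff_ae_muT.2 (hμ.ae_muT_iff.2 ?_)
      filter_upwards [hae] with y hy x hx
      rw [hx, hy]
    have hset : MeasurableSet {y | r y ≤ j} := measurableSet_le hr measurable_const
    calc ∫⁻ b in D', Measure.count (E ∩ 𝒢.src ⁻¹' {𝒢.tgt b}) ∂(𝒢.muS μ)
        = ∫⁻ b in D', N (𝒢.tgt b) ∂(𝒢.muS μ) :=
          lintegral_congr_ae (ae_restrict_of_ae hae')
      _ ≤ ∫⁻ b in 𝒢.tgt ⁻¹' {y | r y ≤ j}, N (𝒢.tgt b) ∂((𝒢.muS μ).restrict B) := by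
          rw [Measure.restrict_restrict (hDm j), inter_comm]
          exact lintegral_mono_set hD'
      _ = ∫⁻ y in {y | r y ≤ j}, N y ∂ν := by
          rw [setLIntegral_map hset hN 𝒢.measurable_tgt]
      _ = ∫⁻ y in {y | r y ≤ j}, r y * N y ∂μ := by
          rw [setLIntegral_rnDeriv_mul hνμ hN.aemeasurable hset]
      _ ≤ ∫⁻ y in {y | r y ≤ j}, j * N y ∂μ := by
          refine setLIntegral_mono (hN.const_mul _) fun y hy => ?_
          gcongr
          exact hy
      _ ≤ ∫⁻ y, j * N y ∂μ := setLIntegral_le_lintegral _ _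
      _ = j * ∫⁻ y, N y ∂μ := lintegral_const_mul _ hN
      _ = ((j : ℝ≥0) : ℝ≥0∞) * 𝒢.muS μ E := by
          rw [hμ.muS_apply hE, lintegral_congr_ae hae, ENNReal.coe_natCast]
  · have hfin : ∀ᵐ x ∂(𝒢.muS μ), r (𝒢.tgt x) < ∞ := by
      refine hμ.ae_muS_iff_ae_muT.2 (hμ.ae_muT_iff.2 ?_)
      filter_upwards [Measure.rnDeriv_lt_top ν μ] with y hy x hx
      rwa [hx]
    filter_upwards [hfin] with x hx hxB
    obtain ⟨j, hj⟩ := ENNReal.exists_nat_gt hx.ne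
    exact ⟨j, hxB, hj.le⟩

theorem IsMeasured.exists_bounded_bisection_cover (hμ : 𝒢.IsMeasured μ) :
    ∃ D : ℕ → Set G, (∀ n, 𝒢.IsBorelBisection (D n)) ∧
      (∀ n, ∀ D' ⊆ D n, MeasurableSet D' → ∃ C : ℝ≥0, ∀ E, MeasurableSet E →
        𝒢.muS μ (𝒢.setMul E D') ≤ C * 𝒢.muS μ E) ∧
      ∀ᵐ x ∂(𝒢.muS μ), ∃ n, x ∈ D n := by
  obtain ⟨B, hB, hcov⟩ := hμ.exists_bisection_cover
  choose D hD hDcov using fun n => hμ.exists_bounded_cover_of_bisection (hB n)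
  refine ⟨fun n => D n.unpair.1 n.unpair.2, fun n => (hB _).mono (hD _ _).1 (hD _ _).2.1,
    fun n => (hD _ _).2.2, ?_⟩
  filter_upwards [hcov, ae_all_iff.2 hDcov] with x ⟨n, hn⟩ hx
  obtain ⟨j, hj⟩ := hx n hn
  exact ⟨Nat.pair n j, by simpa using hj⟩

/-! ### The commutants -/

theorem IsMeasured.muS_units_ne_top (hμ : 𝒢.IsMeasured μ) : 𝒢.muS μ 𝒢.units ≠ ∞ :=
  ne_top_of_le_ne_top ENNReal.one_ne_top (hμ.muS_le_one 𝒢.measurableSet_units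
    fun x hx y hy h => by
      have hx' : 𝒢.src x = x := hx
      have hy' : 𝒢.src y = y := hy
      rw [← hx', h, hy'])

/-- With `ξ` the indicator of the units, λ_E ξ = 1_E, so T 1_E = λ_E (T ξ) = 1_E * Tξ. This
identifies T with right convolution by Tξ on indicators of bisections, and hence everywhere. -/
theorem IsMeasured.centralizer_leftTranslations_subset (hμ : 𝒢.IsMeasured μ) (ω : 𝒢.Cocycle) :
    Set.centralizer {T | ∃ A, 𝒢.IsBorelBisection A ∧ IsLeftTranslation μ ω A T} ⊆
      rightConvolvers μ ω.conj := by
  intro T hT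
  obtain ⟨B, hB, hcov⟩ := hμ.exists_bisection_cover
  let ξ : 𝒢.L2 μ := indicatorConstLp 2 𝒢.measurableSet_units hμ.muS_units_ne_top 1
  refine ⟨T ξ, hμ.isRightConv_of_cover hB hcov fun n E hE hfin hsub => ?_⟩
  have hEB := (hB n).mono hsub hE
  obtain ⟨S, hS, -⟩ := hμ.existsUnique_isLeftTranslation ω hEB
  have hSξ : S ξ = indicatorConstLp 2 hE hfin 1 := by
    refine Lp.ext (((isLeftTranslation_iff hEB).1 hS _ _ _).trans ?_)
    rw [show {g | 𝒢.src g = g} = 𝒢.units from rfl, conv_indicator_units ω hEB.injOn_tgt]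
    exact (indicatorConstLp_one_ae_eq hE hfin).symm
  have hcomm : S (T ξ) = T (S ξ) :=
    DFunLike.congr_fun (Set.mem_centralizer_iff.1 hT S ⟨E, hEB, hS⟩) ξ
  rw [← hSξ, ← hcomm]
  exact ((hμ.isLeftConv_of_isLeftTranslation hEB hS).2 (T ξ)).trans
    (hμ.conv_ae_eq ω (indicatorConstLp_one_ae_eq hE _) (EventuallyEq.refl _ _))

/-- The mirror image, in which ρ for the bisection E⁻¹ sends `ξ` to 1_E. It requires a cover by
bisections all of whose Borel subsets have bounded right translation. -/
theorem IsMeasured.centralizer_rightTranslations_subset (hμ : 𝒢.IsMeasured μ) (ω : 𝒢.Cocycle) :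
    Set.centralizer {T | ∃ A, 𝒢.IsBorelBisection A ∧ IsRightTranslation μ ω.conj A T} ⊆
      leftConvolvers μ ω := by
  intro T hT
  obtain ⟨B, hB, hbdd, hcov⟩ := hμ.exists_bounded_bisection_cover
  let ξ : 𝒢.L2 μ := indicatorConstLp 2 𝒢.measurableSet_units hμ.muS_units_ne_top 1
  refine ⟨T ξ, hμ.isLeftConv_of_cover hB hcov fun n E hE hfin hsub => ?_⟩
  have hEB := (hB n).mono hsub hE
  obtain ⟨C, hC⟩ := hbdd n E hsub hE
  obtain ⟨S, hS, -⟩ := hμ.existsUnique_isRightTranslation ω hEB.setInv (C := C)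
    (by rwa [setInv_setInv])
  have hSξ : S ξ = indicatorConstLp 2 hE hfin 1 := by
    refine Lp.ext (((isRightTranslation_conj_iff hEB.setInv).1 hS _ _ _).trans ?_)
    rw [show {g | 𝒢.src g = g} = 𝒢.units from rfl, setInv_setInv,
      conv_units_indicator ω hEB.injOn_src]
    exact (indicatorConstLp_one_ae_eq hE hfin).symm
  have hcomm : S (T ξ) = T (S ξ) :=
    DFunLike.congr_fun (Set.mem_centralizer_iff.1 hT S ⟨_, hEB.setInv, hS⟩) ξ
  rw [← hSξ, ← hcomm]
  have h := (hμ.isRightConv_of_isRightTranslation hEB.setInv hS).2 (T ξ)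
  rw [ω.conj_conj] at h
  refine h.trans (hμ.conv_ae_eq ω (EventuallyEq.refl _ _) ?_)
  have h' := indicatorConstLp_one_ae_eq hEB.setInv.setInv.measurableSet
    (hEB.setInv.setInv.muS_ne_top hμ)
  exact h'.trans (by rw [setInv_setInv])

theorem IsMeasured.leftConvolvers_subset_centralizer (hμ : 𝒢.IsMeasured μ) (ω : 𝒢.Cocycle) :
    leftConvolvers μ ω ⊆ Set.centralizer (rightConvolvers μ ω.conj) := by
  rintro T ⟨f, -, hT⟩ S ⟨h, -, hS⟩
  exact (hμ.commute_leftConv_rightConv hT hS).symm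

/-- The chain {λ}' ⊆ RC ⊆ LC' ⊆ {λ}' closes up: the middle inclusion is the commutation of L_f with
R_h, and the last holds because translations are convolvers. -/
theorem IsMeasured.centralizer_leftTranslations (hμ : 𝒢.IsMeasured μ) (ω : 𝒢.Cocycle) :
    Set.centralizer {T | ∃ A, 𝒢.IsBorelBisection A ∧ IsLeftTranslation μ ω A T} =
        rightConvolvers μ ω.conj ∧
      Set.centralizer (leftConvolvers μ ω) = rightConvolvers μ ω.conj := by
  have h1 : rightConvolvers μ ω.conj ⊆ Set.centralizer (leftConvolvers μ ω) :=
    Set.subset_centralizer_centralizer.trans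
      (Set.centralizer_subset (hμ.leftConvolvers_subset_centralizer ω))
  have h2 : Set.centralizer (leftConvolvers μ ω) ⊆
      Set.centralizer {T | ∃ A, 𝒢.IsBorelBisection A ∧ IsLeftTranslation μ ω A T} := by
    refine Set.centralizer_subset ?_
    rintro T ⟨A, hA, hT⟩
    exact ⟨_, hμ.isLeftConv_of_isLeftTranslation hA hT⟩
  have h3 := hμ.centralizer_leftTranslations_subset ω
  exact ⟨h3.antisymm (h1.trans h2), (h2.trans h3).antisymm h1⟩

theorem IsMeasured.centralizer_rightTranslations (hμ : 𝒢.IsMeasured μ) (ω : 𝒢.Cocycle) :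
    Set.centralizer {T | ∃ A, 𝒢.IsBorelBisection A ∧ IsRightTranslation μ ω.conj A T} =
        leftConvolvers μ ω ∧
      Set.centralizer (rightConvolvers μ ω.conj) = leftConvolvers μ ω := by
  have h1 := hμ.leftConvolvers_subset_centralizer ω
  have h2 : Set.centralizer (rightConvolvers μ ω.conj) ⊆
      Set.centralizer {T | ∃ A, 𝒢.IsBorelBisection A ∧ IsRightTranslation μ ω.conj A T} := by
    refine Set.centralizer_subset ?_
    rintro T ⟨A, hA, hT⟩
    exact ⟨_, hμ.isRightConv_of_isRightTranslation hA hT⟩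
  have h3 := hμ.centralizer_rightTranslations_subset ω
  exact ⟨h3.antisymm (h1.trans h2), (h2.trans h3).antisymm h1⟩

end DiscreteBorelGroupoid

open DiscreteBorelGroupoid in
/-- The first four conjuncts say that the operators in the definitions of the four algebras exist
(and are bounded and unique); the last four are the equalities of the algebras. -/
theorem mainTheorem11 {G : Type*} [MeasurableSpace G] [StandardBorelSpace G]
    (𝒢 : DiscreteBorelGroupoid G) (μ : Measure G) (hμ : 𝒢.IsMeasured μ) (ω : 𝒢.Cocycle) :
    (∀ A, 𝒢.IsBorelBisection A → ∃! T, IsLeftTranslation μ ω A T) ∧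
    (∀ A, 𝒢.IsBorelBisection A →
      (∃ c : ℝ≥0, ∀ E, MeasurableSet E →
        𝒢.muS μ (𝒢.setMul E (𝒢.setInv A)) ≤ c * 𝒢.muS μ E) →
      ∃! T, IsRightTranslation μ ω.conj A T) ∧
    (∀ f, IsLeftConvolver μ ω f → ∃! T, IsLeftConv μ ω f T) ∧
    (∀ f, IsRightConvolver μ ω.conj f → ∃! T, IsRightConv μ ω.conj f T) ∧
    leftVN μ ω = leftConvolvers μ ω ∧
    leftConvolvers μ ω = Set.centralizer (rightVN μ ω.conj) ∧
    rightVN μ ω.conj = rightConvolvers μ ω.conj ∧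
    rightConvolvers μ ω.conj = Set.centralizer (leftVN μ ω) := by
  obtain ⟨hl, hl'⟩ := hμ.centralizer_leftTranslations ω
  obtain ⟨hr, hr'⟩ := hμ.centralizer_rightTranslations ω
  refine ⟨fun A hA => hμ.existsUnique_isLeftTranslation ω hA,
    fun A hA ⟨C, hC⟩ => hμ.existsUnique_isRightTranslation ω hA hC,
    fun f hf => hμ.existsUnique_isLeftConv hf, fun f hf => hμ.existsUnique_isRightConv hf,
    ?_, ?_, ?_, ?_⟩
  · rw [leftVN, hl, hr']
  · rw [rightVN, hr, hl', hr']
  · rw [rightVN, hr, hl']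
  · rw [leftVN, hl, hr', hl']
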